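/- Let $E/\mathbb{Q}$ be a finite Galois extension with $\mathrm{Gal}(E/\mathbb{Q})\cong A_4$, and suppose that exactly one rational prime $p$ ramifies in $E$. Then all ramification of $E/\mathbb{Q}$ is of type $3$-cycle. That is, $E/\mathbb{Q}$ is tamely ramified (for every rational prime $\ell$ and every prime $\mathfrak{P}$ of $\mathcal{O}_E$ above $\ell$, the ramification index $e(\mathfrak{P}/\ell)$ is not divisible by $\ell$), and every nonzero prime ideal $\mathfrak{P}$ of $\mathcal{O}_E$ either is unramified over $\mathbb{Q}$ or has inertia group generated by an element of $\mathrm{Gal}(E/\mathbb{Q})$ that corresponds to a $3$-cycle under the identification $\mathrm{Gal}(E/\mathbb{Q})\cong A_4$. (This holds for every choice of the isomorphism.) -/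

import Mathlib

open NumberField

/-- A rational prime `p` is ramified in the number field `E` if some prime ideal of `𝓞 E`
containing `p` is ramified over `ℤ`. -/
def RationalPrimeRamifies (E : Type*) [Field E] [NumberField E] (p : ℕ) : Prop :=
  p.Prime ∧ ∃ (P : Ideal (𝓞 E)) (_ : P.IsPrime),
    (p : 𝓞 E) ∈ P ∧ ¬ Algebra.IsUnramifiedAt ℤ P

/-- `E/ℚ` is tamely ramified: for every prime ideal `P` of `𝓞 E` with residue characteristic `p`,
the ramification index of `P` over `ℤ` is not divisible by `p`. (Residue field extensions are
extensions of finite fields, hence separable.) -/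
def IsTamelyRamified (E : Type*) [Field E] [NumberField E] : Prop :=
  ∀ (P : Ideal (𝓞 E)) (p : ℕ), P.IsPrime → p.Prime → (p : 𝓞 E) ∈ P →
    ¬ p ∣ P.ramificationIdx ℤ

/-- All ramification of `E/ℚ` is of type `c`, for a set `c` of elements of the Galois group:
`E/ℚ` is tamely ramified, and every nonzero prime ideal `P` of `𝓞 E` is either unramified over `ℤ`
or has an inertia group generated by an element of `c`. -/
def AllRamificationOfType (E : Type*) [Field E] [NumberField E] (c : Set Gal(E/ℚ)) : Prop :=
  IsTamelyRamified E ∧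
    ∀ (P : Ideal (𝓞 E)) (_ : P.IsPrime), P ≠ ⊥ →
      Algebra.IsUnramifiedAt ℤ P ∨ ∃ g ∈ c, Subgroup.zpowers g = P.inertia Gal(E/ℚ)

/-! Since ℚ has no nontrivial unramified extension, some inertia group is not contained in the Klein
four-group V. Primes over p are conjugate, so every inertia group there contains an element τ of
order 3, and is ⟨τ⟩ or A₄. As ⟨τ⟩ is self-normalizing, decomposition equals inertia and the residue
field is 𝔽_p. Inertia acts on P/P² by scalars, faithfully on elements of order prime to p. If p = 2,
the scalar of τ is 1, so τ = 1, absurd. If p is odd and inertia is A₄, all three involutions of V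
act as -1, yet one is the product of the other two. Hence inertia is generated by a 3-cycle
(`exists_inertia_eq_zpowers`), and ramification is tame unless p = 3.

Excluding p = 3 is global (`not_ramifies_only_three`). Let K be the quartic field fixed by a point
stabilizer. The wild filtration at 3 breaks as early as possible, which gives |disc K| ≤ 81.
Minkowski's discriminant bound excludes K totally real. Otherwise complex conjugation is a double
transposition and K is totally complex; the convex body theorem yields a nonzero integer of K with
small conjugates. Because A₄ is even, its discriminant is the square of an integer, and that integer
is divisible by 9. A finite search leaves six characteristic polynomials up to sign, each
incompatible with the archimedean bounds. -/

/-! ### Action of inertia on powers of a prime -/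

section LocalAction

variable {R G : Type*} [CommRing R] [Group G] [MulSemiringAction G R]

/-- Twisted Leibniz rule: σ(ab) - ab = (σa - a)σb + a(σb - b). -/
theorem smul_sub_mem_pow_add {P : Ideal R} {σ : G} {m : ℕ}
    (h₀ : ∀ x : R, σ • x - x ∈ P ^ m) (h₁ : ∀ x ∈ P, σ • x - x ∈ P ^ (m + 1)) (k : ℕ) :
    ∀ x ∈ P ^ k, σ • x - x ∈ P ^ (k + m) := by
  induction k with
  | zero => intro x _; simpa using h₀ x
  | succ k ih =>
    intro x hx
    rw [pow_succ] at hx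
    induction hx using Submodule.mul_induction_on' with
    | mem_mul_mem a ha b hb =>
      have hb' : σ • b ∈ P := by
        have h := P.add_mem (Ideal.pow_le_self (by lia) (h₁ b hb)) hb
        simpa using h
      have e : σ • (a * b) - a * b = (σ • a - a) * (σ • b) + a * (σ • b - b) := by
        rw [smul_mul']; ring
      rw [e]
      refine Ideal.add_mem _ ?_ ?_
      · have := Ideal.mul_mem_mul (ih a ha) hb'
        rw [← pow_succ] at this
        convert this using 2; ring
      · have := Ideal.mul_mem_mul ha (h₁ b hb)
        rw [← pow_add] at this
        convert this using 2; ring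
    | add a _ b _ ha hb =>
      have e : σ • (a + b) - (a + b) = (σ • a - a) + (σ • b - b) := by rw [smul_add]; ring
      rw [e]; exact Ideal.add_mem _ ha hb

theorem smul_pow_sub_mem {I J : Ideal R} {σ : G} (hJI : J ≤ I)
    (h : ∀ x ∈ I, σ • x - x ∈ J) (i : ℕ) : ∀ x ∈ I, σ ^ i • x - x ∈ J := by
  induction i with
  | zero => simp
  | succ i ih =>
    intro x hx
    have e : σ ^ (i + 1) • x - x = (σ ^ i • (σ • x) - σ • x) + (σ • x - x) := by
      rw [pow_succ, mul_smul]; ring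
    have hσ : σ • x ∈ I := by simpa using I.add_mem (hJI (h x hx)) hx
    rw [e]; exact J.add_mem (ih _ hσ) (h x hx)

theorem mem_pow_of_mul_mem_pow [IsDedekindDomain R] {P : Ideal R} (hP : P.IsPrime)
    {n x : R} (hn : n ∉ P) {k : ℕ} (h : n * x ∈ P ^ k) : x ∈ P ^ k :=
  (Ideal.IsPrime.mul_mem_pow P h).resolve_left hn

/-- With v the P-adic valuation, `x ∉ P ^ (k + 1)` encodes v(x) ≤ k; this is additivity of v. -/
theorem mul_notMem_pow [IsDedekindDomain R] {P : Ideal R} (hP : P.IsPrime) (hP0 : P ≠ ⊥)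
    {x y : R} {k l : ℕ} (hx : x ∉ P ^ (k + 1)) (hy : y ∉ P ^ (l + 1)) :
    x * y ∉ P ^ (k + l + 1) := by
  classical
  intro h
  have hp := Ideal.prime_of_isPrime hP0 hP
  have key : ∀ z : R, ∀ n : ℕ, z ∈ P ^ n ↔ (n : ℕ∞) ≤ emultiplicity P (Ideal.span {z}) := by
    intro z n
    rw [← pow_dvd_iff_le_emultiplicity, Ideal.dvd_span_singleton]
  rw [key] at hx hy h
  rw [← Ideal.span_singleton_mul_span_singleton, emultiplicity_mul hp] at h
  push Not at hx hy
  have hx' : emultiplicity P (Ideal.span {x}) ≤ (k : ℕ∞) := by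
    exact Order.le_of_lt_add_one (by simpa using hx)
  have hy' : emultiplicity P (Ideal.span {y}) ≤ (l : ℕ∞) := by
    exact Order.le_of_lt_add_one (by simpa using hy)
  have := h.trans (add_le_add hx' hy')
  norm_cast at this
  lia

theorem eq_of_forall_sub_mem_pow [IsDomain R] [IsNoetherianRing R] {P : Ideal R} (hP : P ≠ ⊤)
    {x y : R} (h : ∀ k : ℕ, x - y ∈ P ^ k) : x = y := by
  have : x - y ∈ (⨅ k : ℕ, P ^ k) := by simpa [Ideal.mem_iInf] using h
  rw [Ideal.iInf_pow_eq_bot_of_isDomain P hP] at this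
  exact sub_eq_zero.mp (by simpa using this)

/-- An element of the inertia group whose order is prime to the residue characteristic and which
acts trivially on the cotangent space acts trivially. -/
theorem smul_eq_of_tame_of_trivial [IsDedekindDomain R] {P : Ideal R} (hP : P.IsPrime)
    {σ : G} (hσ : σ ∈ P.inertia G) {n : ℕ} (hn : (n : R) ∉ P) (hσn : σ ^ n = 1)
    (h₁ : ∀ x ∈ P, σ • x - x ∈ P ^ 2) (x : R) : σ • x = x := by
  have h₀ : ∀ x : R, σ • x - x ∈ P ^ 1 := by simpa using hσ
  suffices H : ∀ k : ℕ, σ • x - x ∈ P ^ (k + 1) from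
    eq_of_forall_sub_mem_pow hP.ne_top fun k ↦ Ideal.pow_le_pow_right k.le_succ (H k)
  intro k
  induction k with
  | zero => exact h₀ x
  | succ k ih =>
    have h := smul_pow_sub_mem (I := P ^ (k + 1)) (J := P ^ (k + 1 + 1))
      (Ideal.pow_le_pow_right (by lia)) (smul_sub_mem_pow_add h₀ h₁ (k + 1))
    -- The sum telescopes to zero, while each of its n terms is congruent to σx - x one power of P
    -- deeper.
    have hsum : ∑ i ∈ Finset.range n, σ ^ i • (σ • x - x) = 0 := by
      have : ∀ i, σ ^ i • (σ • x - x) = σ ^ (i + 1) • x - σ ^ i • x := by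
        intro i; rw [smul_sub, pow_succ, mul_smul]
      simp_rw [this]
      rw [Finset.sum_range_sub (fun i ↦ σ ^ i • x), hσn]; simp
    have : (n : R) * (σ • x - x) ∈ P ^ (k + 1 + 1) := by
      have h2 : ∑ i ∈ Finset.range n, (σ ^ i • (σ • x - x) - (σ • x - x)) ∈ P ^ (k + 1 + 1) :=
        Ideal.sum_mem _ fun i _ ↦ h i _ ih
      rw [Finset.sum_sub_distrib, hsum, zero_sub, neg_mem_iff] at h2
      simpa only [Finset.sum_const, Finset.card_range, nsmul_eq_mul] using h2
    exact mem_pow_of_mul_mem_pow hP hn this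

/-- The inertia group acts on the cotangent space by scalars. -/
theorem exists_scalar_of_mem_inertia [IsDedekindDomain R] {P : Ideal R} (hP : P.IsPrime)
    (hP0 : P ≠ ⊥) {σ : G} (hσ : σ ∈ P.inertia G) :
    ∃ c : R, ∀ x ∈ P, σ • x - c * x ∈ P ^ 2 := by
  obtain ⟨π, hπ, hπ'⟩ : ∃ π ∈ P, π ∉ P ^ 2 :=
    SetLike.exists_of_lt (Ideal.pow_lt_self P hP0 hP.ne_top 2 le_rfl)
  have hmem : ∀ x ∈ P, σ • x ∈ P := fun x hx ↦ by simpa using P.add_mem (hσ x) hx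
  have hmem2 : ∀ x ∈ P ^ 2, σ • x ∈ P ^ 2 := by
    intro x hx
    rw [pow_two] at hx ⊢
    induction hx using Submodule.mul_induction_on' with
    | mem_mul_mem a ha b hb => rw [smul_mul']; exact Ideal.mul_mem_mul (hmem a ha) (hmem b hb)
    | add a _ b _ ha hb => rw [smul_add]; exact Ideal.add_mem _ ha hb
  -- P/P² is spanned by π and σ fixes residues, so the scalar of π serves every x = dπ.
  have hrep : ∀ x ∈ P, ∃ d, x - d * π ∈ P ^ 2 := by
    intro x hx
    obtain ⟨d, e, he, h⟩ := Ideal.exists_mul_add_mem_pow_succ hP0 (i := 1) π x (by simpa using hπ)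
      (by simpa using hπ') (by simpa using hx)
    exact ⟨d, by rw [← h]; simpa [mul_comm] using he⟩
  obtain ⟨c, hc⟩ := hrep _ (hmem π hπ)
  refine ⟨c, fun x hx ↦ ?_⟩
  obtain ⟨d, hd⟩ := hrep x hx
  have e : σ • x - c * x = σ • (x - d * π) + (σ • d - d) * (σ • π) + d * (σ • π - c * π)
      - c * (x - d * π) := by
    rw [smul_sub, smul_mul']; ring
  rw [e]
  refine sub_mem (add_mem (add_mem (hmem2 _ hd) ?_) (Ideal.mul_mem_left _ _ hc))
    (Ideal.mul_mem_left _ _ hd)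
  rw [pow_two]; exact Ideal.mul_mem_mul (hσ d) (hmem π hπ)

end LocalAction

/-! ### Wild action with prime residue field -/

section LocalAction

variable {R G : Type*} [CommRing R] [Group G] [MulSemiringAction G R]

/-- If the residue field is a prime field, then an element of the inertia group moves every element
at least as little (in the sense of the ramification filtration) as it moves a uniformizer. -/
theorem smul_sub_mem_of_uniformizer [IsDedekindDomain R] {P : Ideal R} (hP0 : P ≠ ⊥)
    (hres : ∀ x : R, ∃ n : ℤ, x - n ∈ P) {σ : G} {m : ℕ}
    (h₀ : ∀ x : R, σ • x - x ∈ P ^ m) (h₁ : ∀ x ∈ P, σ • x - x ∈ P ^ (m + 1)) {y : R}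
    (hy : y ∈ P) (hy2 : y ∉ P ^ 2) [P.IsPrime] (hσy : σ • y - y ∈ P ^ (m + 2)) :
    (∀ x : R, σ • x - x ∈ P ^ (m + 1)) ∧ ∀ x ∈ P, σ • x - x ∈ P ^ (m + 2) := by
  have hint : ∀ n : ℤ, σ • (n : R) = n := fun n ↦ map_intCast (MulSemiringAction.toRingHom G R σ) n
  have H : ∀ x ∈ P, σ • x - x ∈ P ^ (m + 2) := by
    -- Integers represent all residues and are fixed by σ, so modulo P² only integer multiples of y
    -- matter; on P² the Leibniz bound gains the extra power.
    intro x hx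
    obtain ⟨d, e, he, h⟩ := Ideal.exists_mul_add_mem_pow_succ hP0 (i := 1) y x (by simpa using hy)
      (by simpa using hy2) (by simpa using hx)
    obtain ⟨n, hn⟩ := hres d
    have hx' : x - n * y ∈ P ^ 2 := by
      have : x - n * y = (d - n) * y + e := by rw [← h]; ring
      rw [this]
      refine add_mem ?_ he
      rw [pow_two]; exact Ideal.mul_mem_mul hn hy
    have h2 := smul_sub_mem_pow_add h₀ h₁ 2 _ hx'
    have e : σ • x - x = n * (σ • y - y) + (σ • (x - n * y) - (x - n * y)) := by
      rw [smul_sub, smul_mul', hint]; ring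
    rw [e]
    exact add_mem (Ideal.mul_mem_left _ _ hσy) (by rwa [add_comm] at h2)
  refine ⟨fun x ↦ ?_, H⟩
  obtain ⟨n, hn⟩ := hres x
  have := H _ hn
  rw [smul_sub, hint, sub_sub_sub_cancel_right] at this
  exact Ideal.pow_le_pow_right (by lia) this

/-- The ramification filtration of an element of order three in the case of ramification index
three over `3` jumps at most at the first possible place. -/
theorem smul_eq_of_wild [IsDedekindDomain R] {P : Ideal R} [hP : P.IsPrime] (hP0 : P ≠ ⊥)
    (hres : ∀ x : R, ∃ n : ℤ, x - n ∈ P) (h3 : (3 : R) ∈ P ^ 3) (h4 : (3 : R) ∉ P ^ 4)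
    {σ : G} (hσ : σ ∈ P.inertia G) (hσ3 : σ ^ 3 = 1)
    (hσ2 : ∀ x ∈ P, σ • x - x ∈ P ^ 2) {y : R}
    (hy : y ∈ P) (hy2 : y ∉ P ^ 2) (hσy : σ • y - y ∈ P ^ 3) (x : R) : σ • x = x := by
  have hint : ∀ n : ℤ, σ • (n : R) = n := fun n ↦ map_intCast (MulSemiringAction.toRingHom G R σ) n
  set y₁ := σ • y with hy₁
  set y₂ := σ • y₁ with hy₂
  have hy₃ : σ • y₂ = y := by
    rw [hy₂, hy₁, ← mul_smul, ← mul_smul, ← pow_two, ← pow_succ, hσ3, one_smul]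
  have hmem : ∀ x ∈ P, σ • x ∈ P := fun x hx ↦ by simpa using P.add_mem (hσ x) hx
  have hnmem : ∀ x ∈ P, x ∉ P ^ 2 → σ • x ∉ P ^ 2 := fun x hx hx2 h ↦
    hx2 (by simpa using sub_mem h (hσ2 x hx))
  have hN3 : y * y₁ * y₂ ∈ P ^ 3 := by
    rw [pow_succ, pow_two]
    exact Ideal.mul_mem_mul (Ideal.mul_mem_mul hy (hmem _ hy)) (hmem _ (hmem _ hy))
  have hN4 : y * y₁ * y₂ ∉ P ^ 4 :=
    mul_notMem_pow hP hP0 (k := 2) (l := 1)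
      (mul_notMem_pow hP hP0 (k := 1) (l := 1) hy2 (hnmem _ hy hy2))
      (hnmem _ (hmem _ hy) (hnmem _ hy hy2))
  have hσN : σ • (y * y₁ * y₂) = y * y₁ * y₂ := by
    rw [smul_mul', smul_mul', hy₃, ← hy₁, ← hy₂]; ring
  have hσt : σ • (y + y₁ + y₂) = y + y₁ + y₂ := by
    rw [smul_add, smul_add, hy₃, ← hy₁, ← hy₂]; ring
  -- The norm N of y has valuation 3, as does 3, so 3 ≡ nN modulo P⁴ with n an integer prime to P.
  obtain ⟨d, e, he, hde⟩ := Ideal.exists_mul_add_mem_pow_succ hP0 (i := 3) (y * y₁ * y₂) 3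
    hN3 hN4 h3
  obtain ⟨n, hn⟩ := hres d
  have h3n : 3 - n * (y * y₁ * y₂) ∈ P ^ 4 := by
    have : 3 - n * (y * y₁ * y₂) = (y * y₁ * y₂) * (d - n) + e := by rw [← hde]; ring
    rw [this]
    refine add_mem ?_ he
    rw [pow_succ]; exact Ideal.mul_mem_mul hN3 hn
  have hnP : (n : R) ∉ P := by
    intro h
    apply h4
    have := add_mem h3n (by rw [pow_succ']; exact Ideal.mul_mem_mul h hN3 :
      n * (y * y₁ * y₂) ∈ P ^ 4)
    simpa using this
  have level : ∀ m : ℕ, (∀ x : R, σ • x - x ∈ P ^ (m + 2)) ∧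
      ∀ x ∈ P, σ • x - x ∈ P ^ (m + 3) := by
    intro m
    induction m with
    | zero =>
      exact smul_sub_mem_of_uniformizer hP0 hres (m := 1) (by simpa using hσ) hσ2 hy hy2 hσy
    | succ m ih =>
      refine smul_sub_mem_of_uniformizer hP0 hres (m := m + 2) ih.1 ih.2 hy hy2 ?_
      have hδ : y₁ - y ∈ P ^ (m + 3) := ih.2 y hy
      have hδδ : σ • (y₁ - y) - (y₁ - y) ∈ P ^ 5 :=
        Ideal.pow_le_pow_right (by lia)
          (smul_sub_mem_pow_add ih.1 ih.2 (m + 3) _ hδ)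
      -- With δ = σy - y, the trace of y is 3y + 3δ + (σδ - δ), hence ≡ nNy modulo P⁵.
      have ht : y + y₁ + y₂ - n * (y * y₁ * y₂) * y ∈ P ^ 5 := by
        have e : y + y₁ + y₂ - n * (y * y₁ * y₂) * y = (3 - n * (y * y₁ * y₂)) * y
            + 3 * (y₁ - y) + (σ • (y₁ - y) - (y₁ - y)) := by
          rw [smul_sub, ← hy₁, ← hy₂]; ring
        rw [e]
        refine add_mem (add_mem ?_ ?_) hδδ
        · rw [pow_succ]; exact Ideal.mul_mem_mul h3n hy
        · have := Ideal.mul_mem_mul h3 hδ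
          rw [← pow_add] at this
          exact Ideal.pow_le_pow_right (by lia) this
      -- Since σ fixes the trace and N, applying σ - 1 leaves nNδ ∈ P^(m+7) up to sign; as v(N) = 3,
      -- δ lies one level deeper than assumed.
      have h5 := smul_sub_mem_pow_add ih.1 ih.2 5 _ ht
      rw [smul_sub, hσt, smul_mul', smul_mul', hσN, hint, ← hy₁] at h5
      by_contra hcon
      refine mul_notMem_pow hP hP0 (k := 3) (l := m + 3)
        (mul_notMem_pow hP hP0 (k := 0) (l := 3) (by simpa using hnP) hN4) hcon ?_
      have e : (n : R) * (y * y₁ * y₂) * (y₁ - y) = -(y + y₁ + y₂ - n * (y * y₁ * y₂) * y₁ -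
        (y + y₁ + y₂ - n * (y * y₁ * y₂) * y)) := by ring
      rw [e, neg_mem_iff]
      exact Ideal.pow_le_pow_right (by lia) h5
  exact eq_of_forall_sub_mem_pow hP.ne_top fun k ↦ Ideal.pow_le_pow_right (by lia) ((level k).1 x)

end LocalAction

/-! ### Inertia groups and ramification indices -/

section Inertia

theorem natCast_mem_of_not_isUnramifiedAt {E : Type*} [Field E] [NumberField E] {p : ℕ}
    (hp : ∀ q : ℕ, RationalPrimeRamifies E q → q = p)
    (P : Ideal (𝓞 E)) [hPp : P.IsPrime] (hP0 : P ≠ ⊥) (hP : ¬ Algebra.IsUnramifiedAt ℤ P) :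
    (p : 𝓞 E) ∈ P := by
  have : NeZero P := ⟨hP0⟩
  have hmem : ((Ideal.absNorm (P.under ℤ) : ℕ) : 𝓞 E) ∈ P := by
    simpa using Int.absNorm_under_mem P
  rwa [hp _ ⟨Nat.absNorm_under_prime P, P, hPp, hmem, hP⟩] at hmem

variable {E : Type*} [Field E] [NumberField E] [IsGalois ℚ E]

theorem card_inertia_eq_ramificationIdx (P : Ideal (𝓞 E)) [P.IsPrime] :
    Nat.card (P.inertia Gal(E/ℚ)) = P.ramificationIdx ℤ := by
  rw [Ideal.card_inertia_eq_ramificationIdxIn (P.under ℤ) P,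
    Ideal.ramificationIdxIn_eq_ramificationIdx _ P Gal(E/ℚ)]

theorem card_inertia_fixedField_eq_ramificationIdx (N : Subgroup Gal(E/ℚ))
    (P : Ideal (𝓞 E)) [P.IsPrime] :
    Nat.card (P.inertia N) = P.ramificationIdx (𝓞 (IntermediateField.fixedField N)) := by
  have : IsGaloisGroup N (IntermediateField.fixedField N) E := IsGaloisGroup.subgroup Gal(E/ℚ) ℚ E N
  have : IsGaloisGroup N (𝓞 (IntermediateField.fixedField N)) (𝓞 E) := 
    IsGaloisGroup.of_isFractionRing _ _ _  (IntermediateField.fixedField N) E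
  rw [Ideal.card_inertia_eq_ramificationIdxIn (P.under (𝓞 (IntermediateField.fixedField N))) P,
    Ideal.ramificationIdxIn_eq_ramificationIdx _ P N]

/-- If N contained every inertia group, multiplicativity of ramification indices would make its
fixed field unramified over ℚ, hence equal to ℚ by Minkowski. -/
theorem exists_inertia_not_le (N : Subgroup Gal(E/ℚ)) (hN : N ≠ ⊤) :
    ∃ P : Ideal (𝓞 E), P.IsPrime ∧ P ≠ ⊥ ∧ ¬ P.inertia Gal(E/ℚ) ≤ N := by
  by_contra! H
  have h1 : Module.finrank ℚ (IntermediateField.fixedField N) ≠ 1 := by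
    intro h
    rw [IntermediateField.finrank_eq_one_iff] at h
    apply hN
    rw [← IntermediateField.fixingSubgroup_fixedField N, h, IntermediateField.fixingSubgroup_bot]
  obtain ⟨q, hq, hq'⟩ := NumberField.exists_not_isUnramifiedAt_int
    (𝒪 := 𝓞 (IntermediateField.fixedField N)) h1
  obtain ⟨⟨P, hP, hPq⟩⟩ := (inferInstance : Nonempty (q.primesOver (𝓞 E)))
  have hq0 : q ≠ ⊥ := by
    rintro rfl
    exact hq' Algebra.isUnramifiedAt_bot
  have hP0 : P ≠ ⊥ := Ideal.ne_bot_of_liesOver_of_ne_bot hq0 P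
  have hle := H P hP hP0
  have hcard : Nat.card (P.inertia N) = Nat.card (P.inertia Gal(E/ℚ)) :=
    Nat.card_congr (Subgroup.subgroupOfEquivOfLe hle).toEquiv
  rw [card_inertia_fixedField_eq_ramificationIdx N P, card_inertia_eq_ramificationIdx,
    Ideal.ramificationIdx_tower (R := ℤ) q P] at hcard
  have : 0 < P.ramificationIdx (𝓞 (IntermediateField.fixedField N)) := Ideal.ramificationIdx_pos _ _
  apply hq'
  rw [← Ideal.ramificationIdx_eq_one_iff]
  nlinarith

open Pointwise in
theorem mem_inertia_smul_iff {R G : Type*} [CommRing R] [Group G] [MulSemiringAction G R]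
    (P : Ideal R) (g σ : G) : σ ∈ (g • P).inertia G ↔ g⁻¹ * σ * g ∈ P.inertia G := by
  simp only [AddSubgroup.mem_inertia, Submodule.mem_toAddSubgroup]
  rw [(MulAction.surjective g (β := R)).forall]
  refine forall_congr' fun x ↦ ?_
  rw [Ideal.mem_pointwise_smul_iff_inv_smul_mem, smul_sub, inv_smul_smul, mul_smul,
    mul_smul]

open Pointwise in
-- Decomposition equal to inertia forces residue degree one.
theorem exists_int_sub_mem (P : Ideal (𝓞 E)) [P.IsPrime] (hP0 : P ≠ ⊥)
    (h : MulAction.stabilizer Gal(E/ℚ) P ≤ P.inertia Gal(E/ℚ))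
    (x : 𝓞 E) : ∃ n : ℤ, x - n ∈ P := by
  have hmax : P.IsMaximal := Ideal.IsPrime.isMaximal inferInstance hP0
  have hmax' : (P.under ℤ).IsMaximal := Ideal.IsMaximal.under ℤ P
  have hcard := Ideal.card_stabilizer_eq_card_inertia_mul_finrank (G := Gal(E/ℚ)) (P.under ℤ) P
  rw [le_antisymm h P.inertia_le_stabilizer] at hcard
  have h1 : P.inertiaDeg ℤ = 1 := by
    have : 0 < Nat.card (P.inertia Gal(E/ℚ)) := Nat.card_pos
    nlinarith
  let : Field (ℤ ⧸ P.under ℤ) := Ideal.Quotient.field _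
  let : Field (𝓞 E ⧸ P) := Ideal.Quotient.field _
  rw [Ideal.inertiaDeg_eq_of_isMaximal (P.under ℤ) P] at h1
  obtain ⟨a, ha⟩ := (Algebra.finrank_eq_one_iff_bijective_algebraMap.mp h1).2
    (Ideal.Quotient.mk P x)
  obtain ⟨n, rfl⟩ := Ideal.Quotient.mk_surjective a
  refine ⟨n, ?_⟩
  rw [← Ideal.Quotient.eq, ← ha]
  simp

end Inertia

/-! ### Subgroups of A₄ -/

section AlternatingGroup

theorem mul_sq_eq_one_of_sq_eq_one : ∀ a b : alternatingGroup (Fin 4),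
    a ^ 2 = 1 → b ^ 2 = 1 → (a * b) ^ 2 = 1 := by
  decide +kernel

theorem isThreeCycle_of_sq_ne_one : ∀ a : alternatingGroup (Fin 4),
    a ^ 2 ≠ 1 → Equiv.Perm.IsThreeCycle (a : Equiv.Perm (Fin 4)) := by
  unfold Equiv.Perm.IsThreeCycle
  decide +kernel

theorem pow_three_eq_one_of_sq_ne_one : ∀ a : alternatingGroup (Fin 4), a ^ 2 ≠ 1 → a ^ 3 = 1 := by
  decide +kernel

/-- Every coset of ⟨a⟩ meets V, and [a, b] is an involution of V whose conjugates by powers of a are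
all three. So a and b generate A₄. -/
theorem exists_mul_pow_eq_conj_commutator : ∀ a b c : alternatingGroup (Fin 4),
    a ^ 2 ≠ 1 → ¬ (b = 1 ∨ b = a ∨ b = a ^ 2) →
    ∃ i j : Fin 3, c * a ^ (i : ℕ) = 1 ∨
      c * a ^ (i : ℕ) = a ^ (j : ℕ) * (a * b * a⁻¹ * b⁻¹) * (a ^ (j : ℕ))⁻¹ := by
  decide +kernel

/-- A₄ has four Sylow 3-subgroups, so each is its own normalizer. -/
theorem eq_pow_of_conj_eq_pow : ∀ a b : alternatingGroup (Fin 4), a ^ 2 ≠ 1 →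
    (b * a * b⁻¹ = 1 ∨ b * a * b⁻¹ = a ∨ b * a * b⁻¹ = a ^ 2) → (b = 1 ∨ b = a ∨ b = a ^ 2) := by
  decide +kernel

theorem exists_sq_ne_one : ∃ a : alternatingGroup (Fin 4), a ^ 2 ≠ 1 := by decide +kernel

theorem exists_commuting_involutions : ∃ a b : alternatingGroup (Fin 4),
    a ≠ 1 ∧ b ≠ 1 ∧ a * b ≠ 1 ∧ a ^ 2 = 1 ∧ b ^ 2 = 1 := by decide +kernel

variable {G : Type*} [Group G] (φ : G ≃* alternatingGroup (Fin 4))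

/-- The subgroup of elements of order at most two of a group isomorphic to `A₄`. -/
def involutionSubgroup : Subgroup G where
  carrier := {g | φ g ^ 2 = 1}
  mul_mem' {a b} ha hb := by
    simp only [Set.mem_ofPred_eq, map_mul] at *
    exact mul_sq_eq_one_of_sq_eq_one _ _ ha hb
  one_mem' := by simp
  inv_mem' {a} ha := by simpa using ha

theorem mem_involutionSubgroup {g : G} : g ∈ involutionSubgroup φ ↔ φ g ^ 2 = 1 := Iff.rfl

theorem involutionSubgroup_ne_top : involutionSubgroup φ ≠ ⊤ := by
  obtain ⟨a, ha⟩ := exists_sq_ne_one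
  intro h
  apply ha
  have : φ.symm a ∈ involutionSubgroup φ := h ▸ Subgroup.mem_top _
  simpa [mem_involutionSubgroup] using this

variable {φ} {τ : G} (hτ : φ τ ^ 2 ≠ 1)
include hτ

theorem mem_zpowers_iff_of_sq_ne_one {σ : G} :
    σ ∈ Subgroup.zpowers τ ↔ (σ = 1 ∨ σ = τ ∨ σ = τ ^ 2) := by
  have h3 : τ ^ 3 = 1 := by
    apply φ.injective; simpa using pow_three_eq_one_of_sq_ne_one _ hτ
  constructor
  · rintro ⟨n, rfl⟩
    have h := Int.emod_emod_of_dvd n (dvd_refl 3)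
    have hn : τ ^ n = τ ^ (n % 3) := by
      conv_lhs => rw [← Int.mul_ediv_add_emod n 3, zpow_add, zpow_mul]
      rw [show τ ^ (3 : ℤ) = 1 from mod_cast h3]; simp
    have : n % 3 = 0 ∨ n % 3 = 1 ∨ n % 3 = 2 := by lia
    simp only [hn]
    rcases this with h | h | h <;> rw [h]
    · simp
    · simp
    · right; right; norm_cast
  · rintro (rfl | rfl | rfl)
    · exact one_mem _
    · exact Subgroup.mem_zpowers _
    · exact pow_mem (Subgroup.mem_zpowers _) _

theorem apply_eq_iff_of_sq_ne_one {σ : G} :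
    σ ∈ Subgroup.zpowers τ ↔ (φ σ = 1 ∨ φ σ = φ τ ∨ φ σ = φ τ ^ 2) := by
  rw [mem_zpowers_iff_of_sq_ne_one hτ, map_eq_one_iff φ φ.injective, φ.injective.eq_iff,
    ← map_pow, φ.injective.eq_iff]

theorem eq_zpowers_or_eq_top {H : Subgroup G} (h : τ ∈ H) :
    H = Subgroup.zpowers τ ∨ H = ⊤ := by
  by_cases hH : H ≤ Subgroup.zpowers τ
  · exact Or.inl (le_antisymm hH (by simpa using h))
  · obtain ⟨σ, hσ, hσ'⟩ := SetLike.not_le_iff_exists.mp hH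
    rw [apply_eq_iff_of_sq_ne_one hτ] at hσ'
    refine Or.inr ((Subgroup.eq_top_iff' H).mpr fun c ↦ ?_)
    obtain ⟨i, j, hij⟩ := exists_mul_pow_eq_conj_commutator (φ τ) (φ σ) (φ c) hτ hσ'
    have hci : c * τ ^ (i : ℕ) ∈ H := by
      simp only [← map_pow, ← map_mul, ← map_inv, map_eq_one_iff φ φ.injective,
        φ.injective.eq_iff] at hij
      rcases hij with hij | hij
      · rw [hij]; exact one_mem _
      · rw [hij]
        have hτj := pow_mem h (j : ℕ)
        exact mul_mem (mul_mem hτj (mul_mem (mul_mem (mul_mem h hσ) (inv_mem h)) (inv_mem hσ)))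
          (inv_mem hτj)
    simpa using mul_mem hci (inv_mem (pow_mem h (i : ℕ)))

theorem mem_zpowers_of_conj_mem {σ : G} (h : σ * τ * σ⁻¹ ∈ Subgroup.zpowers τ) :
    σ ∈ Subgroup.zpowers τ := by
  rw [apply_eq_iff_of_sq_ne_one hτ] at h ⊢
  exact eq_pow_of_conj_eq_pow _ _ hτ (by simpa using h)

end AlternatingGroup

/-! ### Inertia at the ramified prime is generated by a 3-cycle -/

section Inertia

theorem ne_bot_of_natCast_mem {E : Type*} [Field E] [NumberField E] {p : ℕ}
    {P : Ideal (𝓞 E)} (hpp : p.Prime) (hpP : (p : 𝓞 E) ∈ P) : P ≠ ⊥ := by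
  rintro rfl
  exact hpp.ne_zero (by exact_mod_cast (Ideal.mem_bot.mp hpP))

variable {E : Type*} [Field E] [NumberField E] [IsGalois ℚ E]
  (φ : Gal(E/ℚ) ≃* alternatingGroup (Fin 4)) {p : ℕ}

open Pointwise in
theorem exists_smul_eq_of_natCast_mem (hpp : p.Prime) (P Q : Ideal (𝓞 E)) [P.IsPrime] [Q.IsPrime]
    (hP : (p : 𝓞 E) ∈ P) (hQ : (p : 𝓞 E) ∈ Q) : ∃ g : Gal(E/ℚ), g • P = Q := by
  have hp' : Prime (p : ℤ) := Nat.prime_iff_prime_int.mp hpp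
  have : P.LiesOver (Ideal.span {(p : ℤ)}) :=
    (Ideal.liesOver_span_iff Ideal.IsPrime.ne_top' hp').mpr (by simpa using hP)
  have : Q.LiesOver (Ideal.span {(p : ℤ)}) :=
    (Ideal.liesOver_span_iff Ideal.IsPrime.ne_top' hp').mpr (by simpa using hQ)
  obtain ⟨g, hg⟩ := Ideal.exists_smul_eq_of_isGaloisGroup (Ideal.span {(p : ℤ)}) P Q Gal(E/ℚ)
  exact ⟨g, hg⟩

theorem eq_one_of_forall_smul_eq (σ : Gal(E/ℚ)) (h : ∀ x : 𝓞 E, σ • x = x) : σ = 1 := by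
  have := IsGaloisGroup.faithful (G := Gal(E/ℚ)) (A := ℤ) (B := 𝓞 E)
  exact FaithfulSMul.eq_of_smul_eq_smul (α := 𝓞 E) (by simpa using h)

variable (hpp : p.Prime) (hp : ∀ q : ℕ, RationalPrimeRamifies E q → q = p)
  (P : Ideal (𝓞 E)) [hP : P.IsPrime] (hpP : (p : 𝓞 E) ∈ P)
include φ hpp hp hpP

open Pointwise in
-- Some prime has inertia outside V; it ramifies, so it lies over p and is conjugate to P, and V is
-- normal.
theorem exists_mem_inertia_sq_ne_one : ∃ τ ∈ P.inertia Gal(E/ℚ), φ τ ^ 2 ≠ 1 := by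
  obtain ⟨Q, hQ, hQ0, hQI⟩ := exists_inertia_not_le _ (involutionSubgroup_ne_top φ)
  obtain ⟨σ, hσ, hσ'⟩ := SetLike.not_le_iff_exists.mp hQI
  have hram : ¬ Algebra.IsUnramifiedAt ℤ Q := by
    intro h
    have h1 := card_inertia_eq_ramificationIdx Q
    rw [Ideal.ramificationIdx_eq_one Q ℤ, Subgroup.card_eq_one] at h1
    rw [h1, Subgroup.mem_bot] at hσ
    exact hσ' (hσ ▸ one_mem _)
  obtain ⟨g, rfl⟩ := exists_smul_eq_of_natCast_mem hpp P Q hpP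
    (natCast_mem_of_not_isUnramifiedAt hp Q hQ0 hram)
  refine ⟨_, (mem_inertia_smul_iff P g σ).mp hσ, fun h ↦ hσ' ?_⟩
  rw [mem_involutionSubgroup]
  have e : σ = g * (g⁻¹ * σ * g) * g⁻¹ := by group
  rw [e, map_mul, map_mul, map_inv, conj_pow, h, mul_one, mul_inv_cancel]

open Pointwise in
-- The decomposition group normalizes inertia, which is all of A₄ or self-normalizing.
theorem stabilizer_le_inertia : MulAction.stabilizer Gal(E/ℚ) P ≤ P.inertia Gal(E/ℚ) := by
  obtain ⟨τ, hτ, hτ'⟩ := exists_mem_inertia_sq_ne_one φ hpp hp P hpP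
  rcases eq_zpowers_or_eq_top hτ' hτ with h | h
  · intro σ hσ
    rw [h]
    apply mem_zpowers_of_conj_mem hτ'
    rw [← h]
    have h2 : σ⁻¹ • P = P := by rw [inv_smul_eq_iff]; exact hσ.symm
    have := (mem_inertia_smul_iff P σ⁻¹ τ).mp (by rwa [h2])
    simpa using this
  · rw [h]; exact le_top

/-- The residue field would be 𝔽₂, whose only nonzero scalar is 1, so τ of odd order would act
trivially. -/
theorem ne_two_of_ramifies : p ≠ 2 := by
  rintro rfl
  obtain ⟨τ, hτ, hτ'⟩ := exists_mem_inertia_sq_ne_one φ hpp hp P hpP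
  have hP0 := ne_bot_of_natCast_mem hpp hpP
  have h2 : (2 : 𝓞 E) ∈ P := by simpa using hpP
  have hres := exists_int_sub_mem P hP0 (stabilizer_le_inertia φ hpp hp P hpP)
  obtain ⟨c, hc⟩ := exists_scalar_of_mem_inertia hP hP0 hτ
  have hcP : c ∉ P := by
    intro hcP
    have : ∀ x ∈ P, x ∈ P ^ 2 := by
      intro x hx
      have hx' : τ⁻¹ • x ∈ P := by simpa using P.add_mem (inv_mem hτ x) hx
      have := add_mem (hc _ hx') (by rw [pow_two]; exact Ideal.mul_mem_mul hcP hx' :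
        c * τ⁻¹ • x ∈ P ^ 2)
      simpa using this
    exact (Ideal.pow_lt_self P hP0 hP.ne_top 2 le_rfl).not_ge this
  have hc1 : c - 1 ∈ P := by
    obtain ⟨n, hn⟩ := hres c
    obtain ⟨k, rfl | rfl⟩ := n.even_or_odd'
    · exfalso
      apply hcP
      have := add_mem hn (P.mul_mem_right (k : 𝓞 E) h2)
      simpa using this
    · have := add_mem hn (P.mul_mem_right (k : 𝓞 E) h2)
      push_cast at this
      convert this using 1; ring
  have h3 : ((3 : ℕ) : 𝓞 E) ∉ P := by
    intro h
    apply hP.one_notMem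
    have := sub_mem h h2
    norm_num at this
    exact this
  have hτ3 : τ ^ 3 = 1 := by
    apply φ.injective; simpa using pow_three_eq_one_of_sq_ne_one _ hτ'
  have h1 : τ = 1 := by
    refine eq_one_of_forall_smul_eq τ (smul_eq_of_tame_of_trivial hP hτ h3 hτ3 fun x hx ↦ ?_)
    have e : τ • x - x = (τ • x - c * x) + (c - 1) * x := by ring
    rw [e]
    refine add_mem (hc x hx) ?_
    rw [pow_two]; exact Ideal.mul_mem_mul hc1 hx
  apply hτ'
  simp [h1]

theorem inertia_ne_top : P.inertia Gal(E/ℚ) ≠ ⊤ := by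
  intro htop
  have hP0 := ne_bot_of_natCast_mem hpp hpP
  have hp2 := ne_two_of_ramifies φ hpp hp P hpP
  have h2 : ((2 : ℕ) : 𝓞 E) ∉ P := by
    intro h
    apply hP.one_notMem
    obtain ⟨a, b, hab⟩ : IsCoprime (2 : ℤ) p := by
      exact Nat.isCoprime_iff_coprime.mpr ((Nat.coprime_primes Nat.prime_two hpp).mpr (Ne.symm hp2))
    have := add_mem (P.mul_mem_left (a : 𝓞 E) h) (P.mul_mem_left (b : 𝓞 E) hpP)
    have e : (a : 𝓞 E) * (2 : ℕ) + b * p = 1 := by exact_mod_cast congrArg (Int.cast : ℤ → 𝓞 E) hab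
    rwa [e] at this
  have key : ∀ σ : Gal(E/ℚ), σ ^ 2 = 1 → σ ≠ 1 → ∀ x ∈ P, σ • x + x ∈ P ^ 2 := by
    intro σ hσ hσ1
    have hσI : σ ∈ P.inertia Gal(E/ℚ) := htop ▸ Subgroup.mem_top σ
    obtain ⟨c, hc⟩ := exists_scalar_of_mem_inertia hP hP0 hσI
    have hcc : ∀ x ∈ P, (c - 1) * ((c + 1) * x) ∈ P ^ 2 := by
      intro x hx
      have hx' : σ • x ∈ P := by simpa using P.add_mem (hσI x) hx
      have h1 := hc _ hx'
      rw [← mul_smul, ← pow_two, hσ, one_smul] at h1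
      have e : (c - 1) * ((c + 1) * x) = -(x - c * σ • x) - c * (σ • x - c * x) := by ring
      rw [e]
      exact sub_mem (neg_mem h1) (Ideal.mul_mem_left _ _ (hc x hx))
    have hc1 : c - 1 ∉ P := by
      intro hc1
      apply hσ1
      refine eq_one_of_forall_smul_eq σ (smul_eq_of_tame_of_trivial hP hσI h2 hσ fun x hx ↦ ?_)
      have e : σ • x - x = (σ • x - c * x) + (c - 1) * x := by ring
      rw [e]
      refine add_mem (hc x hx) ?_
      rw [pow_two]; exact Ideal.mul_mem_mul hc1 hx
    intro x hx
    have := mem_pow_of_mul_mem_pow hP hc1 (hcc x hx)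
    have e : σ • x + x = (σ • x - c * x) + (c + 1) * x := by ring
    rw [e]
    exact add_mem (hc x hx) this
  obtain ⟨a, b, ha, hb, hab, ha2, hb2⟩ := exists_commuting_involutions
  have hab2 := mul_sq_eq_one_of_sq_eq_one a b ha2 hb2
  have tr : ∀ a : alternatingGroup (Fin 4), a ≠ 1 → a ^ 2 = 1 →
      ∀ x ∈ P, φ.symm a • x + x ∈ P ^ 2 := fun a ha ha2 ↦
    key _ (by rw [← map_pow, ha2, map_one]) (by simpa using ha)
  obtain ⟨π, hπ, hπ'⟩ : ∃ π ∈ P, π ∉ P ^ 2 :=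
    SetLike.exists_of_lt (Ideal.pow_lt_self P hP0 hP.ne_top 2 le_rfl)
  have h1 := tr b hb hb2 π hπ
  have hbπ : φ.symm b • π ∈ P := by
    have : φ.symm b ∈ P.inertia Gal(E/ℚ) := htop ▸ Subgroup.mem_top _
    simpa using P.add_mem (this π) hπ
  have h2' := tr a ha ha2 _ hbπ
  rw [← mul_smul, ← map_mul] at h2'
  have h3 := tr (a * b) hab hab2 π hπ
  apply hπ'
  refine mem_pow_of_mul_mem_pow hP h2 ?_
  -- On P/P² the element ab acts both as -1 and as (-1)(-1) = 1, so 2π ∈ P².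
  have e : ((2 : ℕ) : 𝓞 E) * π = (φ.symm (a * b) • π + π) + (φ.symm b • π + π) -
      (φ.symm (a * b) • π + φ.symm b • π) := by push_cast; ring
  rw [e]
  exact sub_mem (add_mem h3 h1) h2'

theorem exists_inertia_eq_zpowers :
    ∃ τ : Gal(E/ℚ), φ τ ^ 2 ≠ 1 ∧ Subgroup.zpowers τ = P.inertia Gal(E/ℚ) := by
  obtain ⟨τ, hτ, hτ'⟩ := exists_mem_inertia_sq_ne_one φ hpp hp P hpP
  exact ⟨τ, hτ', ((eq_zpowers_or_eq_top hτ' hτ).resolve_right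
    (inertia_ne_top φ hpp hp P hpP)).symm⟩

end Inertia

/-! ### Point stabilizers and equivariant families of conjugates -/

section PointStabilizer

theorem exists_conj_generates_stabilizer : ∀ a : alternatingGroup (Fin 4), a ^ 2 ≠ 1 →
    ∃ b : alternatingGroup (Fin 4), ∀ c : alternatingGroup (Fin 4),
      (c : Equiv.Perm (Fin 4)) 0 = 0 ↔
        (c = 1 ∨ c = b * a * b⁻¹ ∨ c = (b * a * b⁻¹) ^ 2) := by
  decide +kernel

theorem exists_apply_zero_eq : ∀ i : Fin 4, ∃ b : alternatingGroup (Fin 4),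
    (b : Equiv.Perm (Fin 4)) 0 = i := by
  decide +kernel

theorem conj_apply_zero_ne : ∀ a b : alternatingGroup (Fin 4), (a : Equiv.Perm (Fin 4)) 0 = 0 →
    a ≠ 1 → (b : Equiv.Perm (Fin 4)) 0 ≠ 0 → ((b * a * b⁻¹ : alternatingGroup (Fin 4)) :
      Equiv.Perm (Fin 4)) 0 ≠ 0 := by
  decide +kernel

theorem exists_apply_eq_of_ne_zero : ∀ i j : Fin 4, i ≠ 0 → j ≠ 0 → i ≠ j →
    ∃ a : alternatingGroup (Fin 4), (a : Equiv.Perm (Fin 4)) 0 = 0 ∧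
      (a : Equiv.Perm (Fin 4)) i = j ∧ a ≠ 1 ∧ a ^ 3 = 1 := by
  decide +kernel

variable {G : Type*} [Group G] (φ : G ≃* alternatingGroup (Fin 4))

/-- The stabilizer of the point `0` in a group identified with `A₄`. -/
def pointStabilizer : Subgroup G :=
  (MulAction.stabilizer (Equiv.Perm (Fin 4)) (0 : Fin 4)).comap
    ((alternatingGroup (Fin 4)).subtype.comp φ.toMonoidHom)

theorem mem_pointStabilizer {g : G} :
    g ∈ pointStabilizer φ ↔ (φ g : Equiv.Perm (Fin 4)) 0 = 0 := Iff.rfl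

theorem exists_conj_mem_pointStabilizer_iff {τ : G} (hτ : φ τ ^ 2 ≠ 1) :
    ∃ g : G, pointStabilizer φ = Subgroup.zpowers (g * τ * g⁻¹) := by
  obtain ⟨b, hb⟩ := exists_conj_generates_stabilizer _ hτ
  refine ⟨φ.symm b, Subgroup.ext fun σ ↦ ?_⟩
  have hne : φ (φ.symm b * τ * (φ.symm b)⁻¹) ^ 2 ≠ 1 := by
    simpa using hτ
  rw [apply_eq_iff_of_sq_ne_one hne, mem_pointStabilizer, hb]
  simp

/-- A family indexed by four points on which the group acts by permuting the points. -/
def IsEquivariantFamily {R : Type*} [SMul G R] (a : Fin 4 → R) : Prop :=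
  ∀ (g : G) (i : Fin 4), g • a i = a ((φ g : Equiv.Perm (Fin 4)) i)

/-- An element sending the point `0` to the point `i`. -/
noncomputable def pointTransport (i : Fin 4) : G :=
  φ.symm (exists_apply_zero_eq i).choose

theorem apply_pointTransport (i : Fin 4) :
    (φ (pointTransport φ i) : Equiv.Perm (Fin 4)) 0 = i := by
  rw [pointTransport, MulEquiv.apply_symm_apply]
  exact (exists_apply_zero_eq i).choose_spec

theorem pointTransport_mul_mem {g : G} {i j : Fin 4}
    (h : (φ g : Equiv.Perm (Fin 4)) i = j) :
    (pointTransport φ j)⁻¹ * (g * pointTransport φ i) ∈ pointStabilizer φ := by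
  have h2 := apply_pointTransport φ i
  have h3 := apply_pointTransport φ j
  rw [mem_pointStabilizer]
  simp only [map_mul, map_inv, Subgroup.coe_mul, Subgroup.coe_inv, Equiv.Perm.mul_apply]
  rw [h2, h, Equiv.Perm.inv_eq_iff_eq, h3]

/-- The translate g • x depends only on the coset of g modulo the stabilizer, that is, on the image
of the point 0. -/
theorem isEquivariantFamily_of_fixed {R : Type*} [MulAction G R] {x : R}
    (hx : ∀ h ∈ pointStabilizer φ, h • x = x) :
    IsEquivariantFamily φ fun i ↦ pointTransport φ i • x := by
  intro g i
  have := hx _ (pointTransport_mul_mem φ (g := g) (i := i) rfl)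
  rw [mul_smul, inv_smul_eq_iff, mul_smul] at this
  exact this

theorem pointTransport_zero_smul {R : Type*} [MulAction G R] {x : R}
    (hx : ∀ h ∈ pointStabilizer φ, h • x = x) : pointTransport φ 0 • x = x :=
  hx _ (apply_pointTransport φ 0)

theorem det_vandermonde_four {R : Type*} [CommRing R] (a : Fin 4 → R) :
    (Matrix.vandermonde a).det = (a 1 - a 0) * (a 2 - a 0) * (a 3 - a 0) * (a 2 - a 1) *
      (a 3 - a 1) * (a 3 - a 2) := by
  rw [Matrix.det_vandermonde]
  simp only [Fin.prod_univ_succ, Fin.prod_Ioi_zero, Fin.prod_Ioi_succ]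
  simp
  ring

/-- Even permutations of the rows preserve the determinant; hence the square root of the
discriminant is rational. -/
theorem smul_det_vandermonde {R : Type*} [CommRing R] [MulSemiringAction G R] {a : Fin 4 → R}
    (ha : IsEquivariantFamily φ a) (g : G) :
    g • (Matrix.vandermonde a).det = (Matrix.vandermonde a).det := by
  have h1 : g • (Matrix.vandermonde a).det =
      (Matrix.vandermonde fun i ↦ a ((φ g : Equiv.Perm (Fin 4)) i)).det := by
    change MulSemiringAction.toRingHom G R g _ = _
    rw [RingHom.map_det]
    congr 1
    ext i j
    simp [Matrix.vandermonde_apply, ← ha g i]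
  have h2 : (Matrix.vandermonde fun i ↦ a ((φ g : Equiv.Perm (Fin 4)) i)) =
      (Matrix.vandermonde a).submatrix (φ g : Equiv.Perm (Fin 4)) id := rfl
  rw [h1, h2, Matrix.det_permute, Equiv.Perm.mem_alternatingGroup.mp (φ g).2]
  simp

end PointStabilizer

/-! ### Discriminants at a wild prime over 3 -/

section WildPrime

variable {E : Type*} [Field E] [NumberField E] [IsGalois ℚ E]
  (φ : Gal(E/ℚ) ≃* alternatingGroup (Fin 4))

theorem pow_mem_and_notMem_of_inertia_card {p : ℕ} (hpp : p.Prime) (P : Ideal (𝓞 E))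
    [hP : P.IsPrime] (hpP : (p : 𝓞 E) ∈ P) {e : ℕ} (he : Nat.card (P.inertia Gal(E/ℚ)) = e) :
    (p : 𝓞 E) ∈ P ^ e ∧ (p : 𝓞 E) ∉ P ^ (e + 1) := by
  have hP0 := ne_bot_of_natCast_mem hpp hpP
  have hp' : Prime (p : ℤ) := Nat.prime_iff_prime_int.mp hpp
  have : P.LiesOver (Ideal.span {(p : ℤ)}) :=
    (Ideal.liesOver_span_iff Ideal.IsPrime.ne_top' hp').mpr (by simpa using hpP)
  have hmap : (Ideal.span {(p : ℤ)}).map (algebraMap ℤ (𝓞 E)) = Ideal.span {(p : 𝓞 E)} := by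
    rw [Ideal.map_span]; simp
  have hne : Ideal.span {(p : 𝓞 E)} ≠ ⊥ := by
    simpa [Ideal.span_singleton_eq_bot] using hpp.ne_zero
  rw [card_inertia_eq_ramificationIdx,
    Ideal.IsDedekindDomain.ramificationIdx_eq_multiplicity (Ideal.span {(p : ℤ)})
    P (by rwa [hmap]), hmap] at he
  have hfin : FiniteMultiplicity P (Ideal.span {(p : 𝓞 E)}) :=
    FiniteMultiplicity.of_prime_left (Ideal.prime_of_isPrime hP0 hP) hne
  constructor
  · rw [← Ideal.dvd_span_singleton, ← he]
    exact pow_multiplicity_dvd _ _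
  · rw [← Ideal.dvd_span_singleton, ← he]
    exact hfin.not_pow_dvd_of_multiplicity_lt (Nat.lt_succ_self _)

variable (hp : ∀ q : ℕ, RationalPrimeRamifies E q → q = 3)

open Pointwise in
include hp in
theorem exists_prime_inertia_eq_pointStabilizer (P : Ideal (𝓞 E)) [P.IsPrime]
    (hpP : ((3 : ℕ) : 𝓞 E) ∈ P) :
    ∃ Q : Ideal (𝓞 E), Q.IsPrime ∧ ((3 : ℕ) : 𝓞 E) ∈ Q ∧
      Q.inertia Gal(E/ℚ) = pointStabilizer φ := by
  obtain ⟨τ, hτ, hI⟩ := exists_inertia_eq_zpowers φ Nat.prime_three hp P hpP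
  obtain ⟨g, hg⟩ := exists_conj_mem_pointStabilizer_iff φ hτ
  refine ⟨g • P, inferInstance, ?_, ?_⟩
  · rw [Ideal.mem_pointwise_smul_iff_inv_smul_mem]
    have : g⁻¹ • ((3 : ℕ) : 𝓞 E) = (3 : ℕ) :=
      map_natCast (MulSemiringAction.toRingHom Gal(E/ℚ) (𝓞 E) g⁻¹) 3
    rwa [this]
  · ext σ
    rw [mem_inertia_smul_iff, ← hI, hg, Subgroup.mem_zpowers_iff, Subgroup.mem_zpowers_iff]
    refine exists_congr fun n ↦ ?_
    rw [conj_zpow, mul_inv_eq_iff_eq_mul, mul_assoc, eq_inv_mul_iff_mul_eq]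

variable (P : Ideal (𝓞 E)) [hP : P.IsPrime] (hpP : ((3 : ℕ) : 𝓞 E) ∈ P)

include φ hp hpP in
theorem wild_facts : P ≠ ⊥ ∧ (∀ x : 𝓞 E, ∃ n : ℤ, x - n ∈ P) ∧ (3 : 𝓞 E) ∈ P ^ 3 ∧
    (3 : 𝓞 E) ∉ P ^ 4 := by
  have hP0 := ne_bot_of_natCast_mem Nat.prime_three hpP
  refine ⟨hP0, exists_int_sub_mem P hP0 (stabilizer_le_inertia φ Nat.prime_three hp P hpP), ?_⟩
  obtain ⟨τ, hτ, hI'⟩ := exists_inertia_eq_zpowers φ Nat.prime_three hp P hpP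
  have hcard : Nat.card (P.inertia Gal(E/ℚ)) = 3 := by
    rw [← hI', Nat.card_zpowers]
    refine orderOf_eq_prime (φ.injective ?_) fun h ↦ hτ (by simp [h])
    simpa using pow_three_eq_one_of_sq_ne_one _ hτ
  simpa using pow_mem_and_notMem_of_inertia_card Nat.prime_three P hpP hcard

variable (hI : P.inertia Gal(E/ℚ) = pointStabilizer φ)
include hp hpP hI

/-- As h³ = 1, its scalar satisfies c³ ≡ 1, that is (c - 1)³ ≡ 0 in characteristic 3, so h is
trivial on P/P². Integer representatives of residues extend the bound from P to the whole ring. -/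
theorem smul_sub_mem_sq {h : Gal(E/ℚ)} (hh : h ∈ pointStabilizer φ) (x : 𝓞 E) :
    h • x - x ∈ P ^ 2 := by
  obtain ⟨hP0, hres, h3, h4⟩ := wild_facts φ hp P hpP
  have hint : ∀ n : ℤ, h • (n : 𝓞 E) = n :=
    fun n ↦ map_intCast (MulSemiringAction.toRingHom _ (𝓞 E) h) n
  obtain ⟨τ, hτ, hI'⟩ := exists_inertia_eq_zpowers φ Nat.prime_three hp P hpP
  have hh3 : h ^ 3 = 1 := by
    rw [← hI, ← hI', mem_zpowers_iff_of_sq_ne_one hτ] at hh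
    have ht3 : τ ^ 3 = 1 := φ.injective (by simpa using pow_three_eq_one_of_sq_ne_one _ hτ)
    rcases hh with rfl | rfl | rfl
    · simp
    · exact ht3
    · rw [pow_right_comm, ht3, one_pow]
  rw [← hI] at hh
  obtain ⟨c, hc⟩ := exists_scalar_of_mem_inertia hP hP0 hh
  obtain ⟨π, hπ, hπ'⟩ : ∃ π ∈ P, π ∉ P ^ 2 :=
    SetLike.exists_of_lt (Ideal.pow_lt_self P hP0 hP.ne_top 2 le_rfl)
  have hmem : ∀ x ∈ P, h • x ∈ P := fun x hx ↦ by simpa using P.add_mem (hh x) hx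
  have hc3 : c - 1 ∈ P := by
    have e3 : h • h • h • π = π := by
      rw [← mul_smul, ← mul_smul, ← pow_three', hh3, one_smul]
    have h1 : (c ^ 3 - 1) * π ∈ P ^ 2 := by
      have e : (c ^ 3 - 1) * π = -((h • h • h • π - c * (h • h • π)) +
        c * (h • h • π - c * (h • π)) + c ^ 2 * (h • π - c * π)) := by
        rw [e3]; ring
      rw [e, neg_mem_iff]
      exact add_mem (add_mem (hc _ (hmem _ (hmem _ hπ)))
        (Ideal.mul_mem_left _ _ (hc _ (hmem _ hπ))))
        (Ideal.mul_mem_left _ _ (hc _ hπ))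
    have h2 : c ^ 3 - 1 ∈ P := by
      by_contra hcon
      exact hπ' (mem_pow_of_mul_mem_pow hP hcon h1)
    have h5 : (c - 1) ^ 3 ∈ P := by
      have e : (c - 1) ^ 3 = (c ^ 3 - 1) + (3 : ℕ) * (c - c ^ 2) := by push_cast; ring
      rw [e]; exact add_mem h2 (Ideal.mul_mem_right _ _ hpP)
    exact hP.mem_of_pow_mem 3 h5
  have hwild : ∀ x ∈ P, h • x - x ∈ P ^ 2 := by
    intro x hx
    have e : h • x - x = (h • x - c * x) + (c - 1) * x := by ring
    rw [e]
    refine add_mem (hc x hx) ?_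
    rw [pow_two]; exact Ideal.mul_mem_mul hc3 hx
  obtain ⟨n, hn⟩ := hres x
  have := hwild _ hn
  rwa [smul_sub, hint, sub_sub_sub_cancel_right] at this

/-- The discriminant of an equivariant family of algebraic integers is divisible by `81`. -/
theorem nine_dvd_of_det_vandermonde {a : Fin 4 → 𝓞 E} (ha : IsEquivariantFamily φ a) {d : ℤ}
    (hd : (d : 𝓞 E) = (Matrix.vandermonde a).det) : 9 ∣ d := by
  obtain ⟨hP0, hres, h3, h4⟩ := wild_facts φ hp P hpP
  have hsub : ∀ i j : Fin 4, i ≠ 0 → j ≠ 0 → i ≠ j → a j - a i ∈ P ^ 2 := by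
    intro i j hi hj hij
    obtain ⟨b, hb, hb', -, -⟩ := exists_apply_eq_of_ne_zero i j hi hj hij
    have := smul_sub_mem_sq φ hp P hpP hI (h := φ.symm b)
      (by rw [mem_pointStabilizer]; simpa using hb) (a i)
    rw [ha] at this
    simpa [hb'] using this
  -- Inertia permutes the points 1, 2, 3 transitively, so three of the six differences lie in P².
  have hd6 : (d : 𝓞 E) ∈ P ^ 6 := by
    rw [hd, det_vandermonde_four, show 6 = 2 + 2 + 2 by rfl, pow_add, pow_add]
    refine Ideal.mul_mem_mul (Ideal.mul_mem_mul (Ideal.mul_mem_left _ _ ?_) ?_) ?_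
    · exact hsub 1 2 (by decide) (by decide) (by decide)
    · exact hsub 1 3 (by decide) (by decide) (by decide)
    · exact hsub 2 3 (by decide) (by decide) (by decide)
  have hdiv : ∀ n : ℤ, (n : 𝓞 E) ∈ P → 3 ∣ n := by
    intro n hn
    by_contra hcon
    obtain ⟨u, v, huv⟩ : IsCoprime (3 : ℤ) n :=
      (Int.prime_three.coprime_iff_not_dvd).mpr hcon
    apply hP.one_notMem
    have := add_mem (P.mul_mem_left (u : 𝓞 E) hpP) (P.mul_mem_left (v : 𝓞 E) hn)
    have e : (u : 𝓞 E) * (3 : ℕ) + v * n = 1 := by exact_mod_cast congrArg (Int.cast : ℤ → 𝓞 E) huv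
    rwa [e] at this
  obtain ⟨k, rfl⟩ := hdiv d (Ideal.pow_le_self (by lia) hd6)
  suffices hk : (k : 𝓞 E) ∈ P by
    obtain ⟨l, rfl⟩ := hdiv k hk
    exact ⟨l, by ring⟩
  by_contra hk
  have h5 : (k : 𝓞 E) * 3 ∈ P ^ 6 := by
    push_cast at hd6; rwa [mul_comm]
  exact h4 (Ideal.pow_le_pow_right (by lia) (mem_pow_of_mul_mem_pow hP hk h5))

open Pointwise in
/-- There is an element of the quartic subfield whose discriminant has minimal `3`-adic
valuation. -/
theorem exists_fixed_not_dvd_det_vandermonde : ∃ x : 𝓞 E, (∀ h ∈ pointStabilizer φ, h • x = x) ∧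
    ∀ d : ℤ, (d : 𝓞 E) = (Matrix.vandermonde fun i ↦ pointTransport φ i • x).det → ¬ 27 ∣ d := by
  classical
  obtain ⟨hP0, hres, h3, h4⟩ := wild_facts φ hp P hpP
  have hstab := stabilizer_le_inertia φ Nat.prime_three hp P hpP
  rw [hI] at hstab
  obtain ⟨τ, hτ, hI'⟩ := exists_inertia_eq_zpowers φ Nat.prime_three hp P hpP
  have ht3 : τ ^ 3 = 1 := φ.injective (by simpa using pow_three_eq_one_of_sq_ne_one _ hτ)
  rw [hI] at hI'
  have hτH : τ ∈ pointStabilizer φ := hI' ▸ Subgroup.mem_zpowers τ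
  set g := pointTransport φ 1 with hg
  have hg1 := apply_pointTransport φ 1
  rw [← hg] at hg1
  set Q := g⁻¹ • P with hQ
  have hmemQ : ∀ z, z ∈ Q ↔ g • z ∈ P := by
    intro z; rw [hQ, Ideal.mem_pointwise_smul_iff_inv_smul_mem, inv_inv]
  have hQprime : Q.IsPrime := inferInstance
  have hQ0 : Q ≠ ⊥ := by
    intro h
    apply hP0
    rw [← smul_inv_smul g P, ← hQ, h]
    simp
  have hQmax : Q.IsMaximal := hQprime.isMaximal hQ0
  have hQP : Q ≠ P := by
    intro h
    have h1 : g⁻¹ ∈ pointStabilizer φ := hstab h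
    have h2 := inv_mem h1
    rw [inv_inv, mem_pointStabilizer, hg1] at h2
    exact absurd h2 (by decide)
  have hQh : ∀ h ∈ pointStabilizer φ, h ≠ 1 → h • Q ≠ Q := by
    intro h hh hh1 heq
    have h1 : g * h * g⁻¹ ∈ pointStabilizer φ := by
      apply hstab
      rw [MulAction.mem_stabilizer_iff, mul_smul, mul_smul, ← hQ, heq, hQ, smul_inv_smul]
    rw [mem_pointStabilizer, map_mul, map_mul, map_inv] at h1
    exact conj_apply_zero_ne (φ h) (φ g) hh (by simpa using hh1) (by rw [hg1]; decide) h1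
  have hτ1 : τ ≠ 1 := fun h ↦ hτ (by simp [h])
  have hτ2 : τ ^ 2 ≠ 1 := fun h ↦ hτ (by rw [← map_pow, h, map_one])
  have hτQ : (τ • Q).IsPrime := inferInstance
  have hτ2Q : (τ ^ 2 • Q).IsPrime := inferInstance
  let f : Fin 4 → Ideal (𝓞 E) := ![Q ^ 2, P, τ • Q, τ ^ 2 • Q]
  -- Prime avoidance gives β of valuation 1 at Q and 0 at P, τQ, τ²Q. For x the product of the
  -- conjugates of β under ⟨τ⟩, `a 1` then has valuation 1 at P and `a 0` is a unit there.
  obtain ⟨β, hβQ, hβ⟩ : ∃ β ∈ Q, ∀ i, β ∉ f i := by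
    by_contra! hcon
    have hsub : (Q : Set (𝓞 E)) ⊆ ⋃ i ∈ ((Finset.univ : Finset (Fin 4)) : Set (Fin 4)), f i := by
      intro z hz
      obtain ⟨i, hi⟩ := hcon z hz
      exact Set.mem_biUnion (Finset.mem_coe.mpr (Finset.mem_univ i)) hi
    -- The lemma tolerates exceptional indices whose ideals need not be prime; Q² sits at such an
    -- index.
    rw [Ideal.subset_union_prime (f := f) 0 0] at hsub
    · obtain ⟨i, -, hi⟩ := hsub
      fin_cases i
      · exact (Ideal.pow_lt_self Q hQ0 hQprime.ne_top 2 le_rfl).not_ge hi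
      · exact hQP (hQmax.eq_of_le hP.ne_top hi)
      · exact hQh τ hτH hτ1 (hQmax.eq_of_le hτQ.ne_top hi).symm
      · exact hQh _ (pow_mem hτH 2) hτ2
          (hQmax.eq_of_le hτ2Q.ne_top hi).symm
    · intro i _ hi _
      fin_cases i
      · exact absurd rfl hi
      · exact hP
      · exact hτQ
      · exact hτ2Q
  have hβ0 : β ∉ Q ^ 2 := hβ 0
  have hβP : β ∉ P := hβ 1
  have hβ1 : β ∉ τ • Q := hβ 2
  have hβ2 : β ∉ τ ^ 2 • Q := hβ 3
  have ht3' : τ * τ ^ 2 = 1 := by rw [← pow_succ', ht3]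
  have hxτ : τ • (β * τ • β * τ ^ 2 • β) = β * τ • β * τ ^ 2 • β := by
    rw [smul_mul', smul_mul', ← mul_smul, ← mul_smul, ht3', one_smul, ← pow_two]; ring
  have hx : ∀ h ∈ pointStabilizer φ, h • (β * τ • β * τ ^ 2 • β) = β * τ • β * τ ^ 2 • β := by
    intro h hh
    rw [← hI', mem_zpowers_iff_of_sq_ne_one hτ] at hh
    rcases hh with rfl | rfl | rfl
    · exact one_smul _ _
    · exact hxτ
    · rw [pow_two τ, mul_smul, ← pow_two τ, hxτ, hxτ]
  refine ⟨_, hx, fun d hd ↦ ?_⟩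
  set x := β * τ • β * τ ^ 2 • β with hxdef
  set a : Fin 4 → 𝓞 E := fun i ↦ pointTransport φ i • x with ha
  have haφ : IsEquivariantFamily φ a := isEquivariantFamily_of_fixed φ hx
  have hτP : ∀ h ∈ pointStabilizer φ, ∀ z, z ∉ P → h • z ∉ P := by
    intro h hh z hz hzP
    rw [← hI] at hh
    exact hz (by simpa using sub_mem hzP (hh z))
  have ha0 : a 0 ∉ P := by
    have : a 0 = x := pointTransport_zero_smul φ hx
    rw [this, hxdef]
    exact hP.mul_notMem (hP.mul_notMem hβP (hτP _ hτH _ hβP)) (hτP _ (pow_mem hτH 2) _ hβP)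
  have ha1 : a 1 = g • β * (g • τ • β) * (g • τ ^ 2 • β) := by
    rw [ha, ← smul_mul', ← smul_mul']
  have ha1P : a 1 ∈ P := by
    rw [ha1]; exact P.mul_mem_right _ (P.mul_mem_right _ ((hmemQ β).mp hβQ))
  have hgτ : g • τ • β ∉ P := by
    rw [← hmemQ]
    intro h
    apply hβ2
    rw [Ideal.mem_pointwise_smul_iff_inv_smul_mem, inv_eq_of_mul_eq_one_left ht3']
    exact h
  have hgτ2 : g • τ ^ 2 • β ∉ P := by
    rw [← hmemQ]
    intro h
    apply hβ1
    rw [Ideal.mem_pointwise_smul_iff_inv_smul_mem, inv_eq_of_mul_eq_one_right ht3']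
    exact h
  have hgβ : g • β ∉ P ^ 2 := by
    intro h
    apply hβ0
    rw [hQ, ← smul_pow', Ideal.mem_pointwise_smul_iff_inv_smul_mem, inv_inv]
    exact h
  have ha1P2 : a 1 ∉ P ^ 2 := by
    rw [ha1]
    exact mul_notMem_pow hP hP0 (k := 1) (l := 0) (mul_notMem_pow hP hP0 (k := 1) (l := 0) hgβ
      (by simpa using hgτ)) (by simpa using hgτ2)
  -- If a difference of two of these uniformizers lay in P³, `smul_eq_of_wild` would make a 3-cycle
  -- trivial.
  have hstep : ∀ i j : Fin 4, i ≠ 0 → j ≠ 0 → i ≠ j → a i ∈ P → a i ∉ P ^ 2 →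
      a j ∈ P ∧ a j ∉ P ^ 2 ∧ a j - a i ∉ P ^ 3 := by
    intro i j hi hj hij hai hai2
    obtain ⟨b, hb, hb', hb1, hb3⟩ := exists_apply_eq_of_ne_zero i j hi hj hij
    have hh : φ.symm b ∈ pointStabilizer φ := by rw [mem_pointStabilizer]; simpa using hb
    have haj : φ.symm b • a i = a j := by rw [haφ]; simp [hb']
    have hsub := smul_sub_mem_sq φ hp P hpP hI hh
    have h2 := hsub (a i)
    rw [haj] at h2
    refine ⟨?_, fun h ↦ hai2 (by simpa using sub_mem h h2), fun h ↦ hb1 ?_⟩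
    · simpa using add_mem (Ideal.pow_le_self two_ne_zero h2) hai
    · rw [← haj] at h
      have hb3' : φ.symm b ^ 3 = 1 := by rw [← map_pow, hb3, map_one]
      simpa using eq_one_of_forall_smul_eq _ (smul_eq_of_wild hP0 hres h3 h4 (hI ▸ hh) hb3'
        (fun x _ ↦ hsub x) hai hai2 h)
  obtain ⟨ha2P, ha2P2, h21⟩ := hstep 1 2 (by decide) (by decide) (by decide) ha1P ha1P2
  obtain ⟨ha3P, -, h31⟩ := hstep 1 3 (by decide) (by decide) (by decide) ha1P ha1P2
  obtain ⟨-, -, h32⟩ := hstep 2 3 (by decide) (by decide) (by decide) ha2P ha2P2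
  have h0 : ∀ i, a i ∈ P → a i - a 0 ∉ P ^ (0 + 1) := by
    intro i hi h
    apply ha0
    have := sub_mem hi (by simpa using h)
    simpa using this
  rintro ⟨k, rfl⟩
  -- The differences have valuations at most 0, 0, 0, 2, 2, 2, total 6, whereas 27 ∈ P⁹.
  have h7 : (Matrix.vandermonde a).det ∉ P ^ 7 := by
    rw [det_vandermonde_four]
    exact mul_notMem_pow hP hP0 (k := 4) (l := 2) (mul_notMem_pow hP hP0 (k := 2) (l := 2)
      (mul_notMem_pow hP hP0 (k := 0) (l := 2) (mul_notMem_pow hP hP0 (k := 0) (l := 0)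
      (mul_notMem_pow hP hP0 (k := 0) (l := 0) (h0 1 ha1P) (h0 2 ha2P)) (h0 3 ha3P)) h21) h31) h32
  apply h7
  rw [← hd]
  have h9 : (3 : 𝓞 E) ^ 3 ∈ P ^ 9 := by
    rw [show 9 = 3 * 3 by rfl, pow_mul]; exact Ideal.pow_mem_pow h3 3
  have e : ((27 * k : ℤ) : 𝓞 E) = 3 ^ 3 * k := by push_cast; norm_num
  rw [e]
  exact Ideal.mul_mem_right _ _ (Ideal.pow_le_pow_right (by lia) h9)

end WildPrime

/-! ### Quartic polynomials with small roots and square discriminant -/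

section SmallQuartics

/-- The discriminant of `X⁴ - e₁ X³ + e₂ X² - e₃ X + e₄`, as the discriminant of its cubic
resolvent. -/
def quarticDisc {R : Type*} [CommRing R] (e₁ e₂ e₃ e₄ : R) : R :=
  let A := e₂
  let B := e₁ * e₃ - 4 * e₄
  let C := e₃ ^ 2 + e₁ ^ 2 * e₄ - 4 * e₂ * e₄
  A ^ 2 * B ^ 2 - 4 * B ^ 3 - 4 * A ^ 3 * C + 18 * A * B * C - 27 * C ^ 2

/-- Each difference of the resolvent roots xy + zw, xz + yw, xw + yz is, up to sign, a product of
two root differences, so quartic and resolvent share their discriminant. -/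
theorem det_vandermonde_sq_eq_quarticDisc {R : Type*} [CommRing R] (a : Fin 4 → R) :
    (Matrix.vandermonde a).det ^ 2 = quarticDisc (a 0 + a 1 + a 2 + a 3)
      (a 0 * a 1 + a 0 * a 2 + a 0 * a 3 + a 1 * a 2 + a 1 * a 3 + a 2 * a 3)
      (a 0 * a 1 * a 2 + a 0 * a 1 * a 3 + a 0 * a 2 * a 3 + a 1 * a 2 * a 3)
      (a 0 * a 1 * a 2 * a 3) := by
  rw [det_vandermonde_four]
  generalize a 0 = x
  generalize a 1 = y
  generalize a 2 = z
  generalize a 3 = w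
  have hB : (x + y + z + w) * (x * y * z + x * y * w + x * z * w + y * z * w) -
      4 * (x * y * z * w) = (x * y + z * w) * (x * z + y * w) + (x * y + z * w) * (x * w + y * z) +
      (x * z + y * w) * (x * w + y * z) := by ring
  have hC : (x * y * z + x * y * w + x * z * w + y * z * w) ^ 2 +
      (x + y + z + w) ^ 2 * (x * y * z * w) -
      4 * (x * y + x * z + x * w + y * z + y * w + z * w) * (x * y * z * w) =
      (x * y + z * w) * (x * z + y * w) * (x * w + y * z) := by ring
  have hA : x * y + x * z + x * w + y * z + y * w + z * w =
      (x * y + z * w) + (x * z + y * w) + (x * w + y * z) := by ring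
  have hD : (y - x) * (z - x) * (w - x) * (z - y) * (w - y) * (w - z) =
      ((x * y + z * w) - (x * z + y * w)) * ((x * y + z * w) - (x * w + y * z)) *
      ((x * z + y * w) - (x * w + y * z)) := by ring
  simp only [quarticDisc]
  rw [hB, hC, hD, hA]
  generalize x * y + z * w = u
  generalize x * z + y * w = v
  generalize x * w + y * z = t
  ring

theorem quarticDisc_neg {R : Type*} [CommRing R] (e₁ e₂ e₃ e₄ : R) :
    quarticDisc (-e₁) e₂ (-e₃) e₄ = quarticDisc e₁ e₂ e₃ e₄ := by
  simp only [quarticDisc]; ring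

/-- If `d` is the discriminant of a quartic with the given coefficients, and it looks like a
nonzero square divisible by `81`, then the quartic is in an explicit list. -/
def SmallQuarticCheck (e₁ e₂ e₃ e₄ d : ℤ) : Prop :=
  -7 ≤ e₁ ^ 2 - 2 * e₂ → e₁ ^ 2 - 2 * e₂ ≤ 6 → 0 < d → d % 81 = 0 →
    (∃ r : Fin 64, (r.val ^ 2 : ℤ) % 64 = d % 64) → (∃ r : Fin 5, (r.val ^ 2 : ℤ) % 5 = d % 5) →
    (∃ r : Fin 7, (r.val ^ 2 : ℤ) % 7 = d % 7) → (∃ r : Fin 11, (r.val ^ 2 : ℤ) % 11 = d % 11) →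
    (∃ r : Fin 13, (r.val ^ 2 : ℤ) % 13 = d % 13) →
    (∃ r : Fin 23, (r.val ^ 2 : ℤ) % 23 = d % 23) →
    (e₁ = 1 ∧ e₂ = 3 ∧ e₃ = -2 ∧ e₄ = 4) ∨ (e₁ = 2 ∧ e₂ = 1 ∧ e₃ = -6 ∧ e₄ = 3) ∨
    (e₁ = 2 ∧ e₂ = 1 ∧ e₃ = 0 ∧ e₄ = 5) ∨ (e₁ = 3 ∧ e₂ = 7 ∧ e₃ = -6 ∧ e₄ = 4) ∨
    (e₁ = 4 ∧ e₂ = 9 ∧ e₃ = -7 ∧ e₄ = 2) ∨ (e₁ = 4 ∧ e₂ = 6 ∧ e₃ = -4 ∧ e₄ = 5)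

instance (e₁ e₂ e₃ e₄ d : ℤ) : Decidable (SmallQuarticCheck e₁ e₂ e₃ e₄ d) := by
  unfold SmallQuarticCheck; infer_instance

/-- Squareness is weakened to squareness modulo 64, 5, 7, 11, 13, 23, which makes the search
decidable and leaves six cases. The range of e₂ comes from the bounds on the power sum e₁² - 2e₂. -/
theorem smallQuarticCheck_quarticDisc : ∀ i : Fin 5, ∀ j : Fin 5, ∀ k : Fin 17, ∀ l : Fin 25,
    SmallQuarticCheck i.val (k.val - 4) (l.val - 12) (j.val + 1)
      (quarticDisc (i.val : ℤ) (k.val - 4) (l.val - 12) (j.val + 1)) := by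
  decide +kernel

theorem exists_fin_sq_mod_eq (n : ℕ) [NeZero n] (D : ℤ) :
    ∃ r : Fin n, (r.val ^ 2 : ℤ) % n = D ^ 2 % n := by
  have hn : (n : ℤ) ≠ 0 := by exact_mod_cast NeZero.ne n
  have h0 := Int.emod_nonneg D hn
  have h1 := Int.emod_lt_of_pos D (by have := NeZero.pos n; exact_mod_cast this : (0 : ℤ) < n)
  refine ⟨⟨(D % n).toNat, by omega⟩, ?_⟩
  rw [Int.toNat_of_nonneg h0]
  exact (Int.mod_modEq D n).pow 2

theorem small_quarticDisc_of_sq {e₁ e₂ e₃ e₄ D : ℤ} (hD : D ^ 2 = quarticDisc e₁ e₂ e₃ e₄)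
    (h9 : 9 ∣ D) (hD0 : D ≠ 0) (h1 : 0 ≤ e₁) (h1' : e₁ ≤ 4) (h4 : 1 ≤ e₄) (h4' : e₄ ≤ 5)
    (h3 : -12 ≤ e₃) (h3' : e₃ ≤ 12) (h2 : -7 ≤ e₁ ^ 2 - 2 * e₂) (h2' : e₁ ^ 2 - 2 * e₂ ≤ 6) :
    (e₁ = 1 ∧ e₂ = 3 ∧ e₃ = -2 ∧ e₄ = 4) ∨ (e₁ = 2 ∧ e₂ = 1 ∧ e₃ = -6 ∧ e₄ = 3) ∨
    (e₁ = 2 ∧ e₂ = 1 ∧ e₃ = 0 ∧ e₄ = 5) ∨ (e₁ = 3 ∧ e₂ = 7 ∧ e₃ = -6 ∧ e₄ = 4) ∨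
    (e₁ = 4 ∧ e₂ = 9 ∧ e₃ = -7 ∧ e₄ = 2) ∨ (e₁ = 4 ∧ e₂ = 6 ∧ e₃ = -4 ∧ e₄ = 5) := by
  have hsq : e₁ ^ 2 ≤ 16 := by nlinarith
  have hsq0 : 0 ≤ e₁ ^ 2 := sq_nonneg _
  have hd0 : 0 < quarticDisc e₁ e₂ e₃ e₄ := by rw [← hD]; positivity
  have hd81 : quarticDisc e₁ e₂ e₃ e₄ % 81 = 0 := by
    rw [← hD]; obtain ⟨k, rfl⟩ := h9
    exact Int.emod_eq_zero_of_dvd ⟨k ^ 2, by ring⟩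
  have H := smallQuarticCheck_quarticDisc ⟨e₁.toNat, by omega⟩ ⟨(e₄ - 1).toNat, by omega⟩
    ⟨(e₂ + 4).toNat, by omega⟩ ⟨(e₃ + 12).toNat, by omega⟩
  dsimp only at H
  rw [Int.toNat_of_nonneg h1, Int.toNat_of_nonneg (by omega : 0 ≤ e₄ - 1),
    Int.toNat_of_nonneg (by omega : 0 ≤ e₂ + 4), Int.toNat_of_nonneg (by omega : 0 ≤ e₃ + 12),
    sub_add_cancel, add_sub_cancel_right, add_sub_cancel_right] at H
  rw [← hD] at *
  exact H h2 h2' hd0 hd81 (exists_fin_sq_mod_eq 64 D) (exists_fin_sq_mod_eq 5 D)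
    (exists_fin_sq_mod_eq 7 D) (exists_fin_sq_mod_eq 11 D) (exists_fin_sq_mod_eq 13 D)
    (exists_fin_sq_mod_eq 23 D)

theorem le_add_of_sq_le {q t c : ℝ} (hq : 0 ≤ q) (ht : 0 ≤ t) (h : c ^ 2 ≤ 4 * (q * t)) :
    c ≤ q + t :=
  le_of_sq_le_sq (by nlinarith [sq_nonneg (q - t)]) (add_nonneg hq ht)

/-- The quartic is (X² - pX + q)(X² - sX + t), one real factor per conjugate pair of roots. The
bounds on the roots confine its coefficients to the searched box and then refute each survivor. -/
theorem no_small_quartic_of_nonneg {p q s t : ℝ} {e₁ e₂ e₃ e₄ D : ℤ}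
    (hD : D ^ 2 = quarticDisc e₁ e₂ e₃ e₄) (h9 : 9 ∣ D) (hD0 : D ≠ 0) (he₄ : e₄ ≠ 0)
    (h1 : (e₁ : ℝ) = p + s) (h2 : (e₂ : ℝ) = q + t + p * s) (h3 : (e₃ : ℝ) = p * t + s * q)
    (h4 : (e₄ : ℝ) = q * t) (hp : -2 < p) (hp' : p < 2) (hpq : p ^ 2 ≤ 4 * q)
    (hq : q - p ^ 2 / 4 < 13 / 8) (hst : s ^ 2 ≤ 4 * t) (ht : t < 9 / 4) (h0 : 0 ≤ e₁) : False := by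
  have hq0 : 0 ≤ q := by nlinarith [sq_nonneg p]
  have ht0 : 0 ≤ t := by nlinarith [sq_nonneg s]
  have hp4 : p ^ 2 < 4 := by nlinarith
  have hq' : q < 21 / 8 := by linarith
  have hs : s < 3 := by nlinarith
  have hs' : -3 < s := by nlinarith
  have b1 : e₁ < 5 := by exact_mod_cast (by rw [h1]; push_cast; linarith : (e₁ : ℝ) < (5 : ℤ))
  have b4 : 0 ≤ e₄ := by exact_mod_cast (by rw [h4]; push_cast; positivity : ((0 : ℤ) : ℝ) ≤ e₄)
  have b4' : e₄ < 6 := by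
    exact_mod_cast (by rw [h4]; push_cast; nlinarith : (e₄ : ℝ) < (6 : ℤ))
  have hpt : |p * t| ≤ 2 * (9 / 4) := by
    rw [abs_mul]
    exact mul_le_mul (abs_le.mpr ⟨by linarith, by linarith⟩) (abs_le.mpr ⟨by linarith, by linarith⟩)
      (abs_nonneg _) (by norm_num)
  have hsq : |s * q| ≤ 3 * (21 / 8) := by
    rw [abs_mul]
    exact mul_le_mul (abs_le.mpr ⟨by linarith, by linarith⟩) (abs_le.mpr ⟨by linarith, by linarith⟩)
      (abs_nonneg _) (by norm_num)
  rw [abs_le] at hpt hsq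
  have b3 : -13 < e₃ := by exact_mod_cast (by rw [h3]; push_cast; linarith : ((-13 : ℤ) : ℝ) < e₃)
  have b3' : e₃ < 13 := by exact_mod_cast (by rw [h3]; push_cast; linarith : (e₃ : ℝ) < (13 : ℤ))
  have hps : (e₁ : ℝ) ^ 2 - 2 * e₂ = (p ^ 2 - 2 * q) + (s ^ 2 - 2 * t) := by rw [h1, h2]; ring
  have b2 : -8 < e₁ ^ 2 - 2 * e₂ := by
    exact_mod_cast (by push_cast; rw [hps]; nlinarith [sq_nonneg p, sq_nonneg s] :
      ((-8 : ℤ) : ℝ) < ((e₁ ^ 2 - 2 * e₂ : ℤ) : ℝ))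
  have b2' : e₁ ^ 2 - 2 * e₂ < 7 := by
    exact_mod_cast (by push_cast; rw [hps]; nlinarith [sq_nonneg p, sq_nonneg s] :
      ((e₁ ^ 2 - 2 * e₂ : ℤ) : ℝ) < ((7 : ℤ) : ℝ))
  rcases small_quarticDisc_of_sq hD h9 hD0 h0 (by omega) (by omega) (by omega) (by omega)
    (by omega) (by omega) (by omega) with
    ⟨rfl, rfl, rfl, rfl⟩ | ⟨rfl, rfl, rfl, rfl⟩ | ⟨rfl, rfl, rfl, rfl⟩ | ⟨rfl, rfl, rfl, rfl⟩ |
    ⟨rfl, rfl, rfl, rfl⟩ | ⟨rfl, rfl, rfl, rfl⟩ <;> push_cast at h1 h2 h3 h4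
  · obtain rfl : s = 1 - p := by linarith
    -- By AM-GM q + t ≥ 4, so p² - p ≥ 1; 8/5 and -3/5 are rational stand-ins for the roots (1 ±
    -- √5)/2.
    have hqt := le_add_of_sq_le (c := 4) hq0 ht0 (by linarith)
    have hpp : 1 ≤ p ^ 2 - p := by linarith
    have hq1 : 16 / 9 ≤ q := by linarith [mul_nonneg hq0 (sub_nonneg.mpr ht.le)]
    have ht1 : 32 / 21 ≤ t := by linarith [mul_nonneg ht0 (sub_nonneg.mpr hq'.le)]
    have hpt2 := mul_nonneg (sub_nonneg.mpr hp.le) ht0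
    have hpq2 := mul_nonneg (sub_nonneg.mpr hp'.le) hq0
    rcases le_or_gt 0 p with h | h
    · have h5 : 0 ≤ p - 8 / 5 := by nlinarith
      linarith [mul_nonneg h5 ht0]
    · have h5 : 0 ≤ -3 / 5 - p := by nlinarith
      linarith [mul_nonneg h5 hq0]
  · obtain rfl : s = 2 - p := by linarith
    -- Here pt ≥ -2t > -9/2 and sq ≥ 0, so e₃ = -6 is out of reach.
    linarith [mul_nonneg (sub_nonneg.mpr hp.le) ht0, mul_nonneg (sub_nonneg.mpr hp'.le) hq0]
  · obtain rfl : s = 2 - p := by linarith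
    -- 22/5 is a rational lower bound for 2√5 = 2√(qt).
    have hqt := le_add_of_sq_le (c := 22 / 5) hq0 ht0 (by linarith)
    have hp1 : 0 ≤ p + 1 := by linarith
    linarith [mul_nonneg hp1 (sub_nonneg.mpr hp'.le)]
  · obtain rfl : s = 3 - p := by linarith
    have hp1 : 0 ≤ p := by linarith
    linarith [mul_nonneg hp1 ht0, mul_nonneg (sub_nonneg.mpr hp'.le) hq0]
  · obtain rfl : s = 4 - p := by linarith
    have hp1 : 0 ≤ p := by linarith
    linarith [mul_nonneg hp1 ht0, mul_nonneg (sub_nonneg.mpr hp'.le) hq0]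
  · obtain rfl : s = 4 - p := by linarith
    have hp1 : 0 ≤ p := by linarith
    linarith [mul_nonneg hp1 ht0, mul_nonneg (sub_nonneg.mpr hp'.le) hq0]

theorem no_small_quartic {p q s t : ℝ} {e₁ e₂ e₃ e₄ D : ℤ}
    (hD : D ^ 2 = quarticDisc e₁ e₂ e₃ e₄) (h9 : 9 ∣ D) (hD0 : D ≠ 0) (he₄ : e₄ ≠ 0)
    (h1 : (e₁ : ℝ) = p + s) (h2 : (e₂ : ℝ) = q + t + p * s) (h3 : (e₃ : ℝ) = p * t + s * q)
    (h4 : (e₄ : ℝ) = q * t) (hp : -2 < p) (hp' : p < 2) (hpq : p ^ 2 ≤ 4 * q)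
    (hq : q - p ^ 2 / 4 < 13 / 8) (hst : s ^ 2 ≤ 4 * t) (ht : t < 9 / 4) : False := by
  rcases le_total 0 e₁ with h0 | h0
  · exact no_small_quartic_of_nonneg hD h9 hD0 he₄ h1 h2 h3 h4 hp hp' hpq hq hst ht h0
  · refine no_small_quartic_of_nonneg (p := -p) (q := q) (s := -s) (t := t) (e₁ := -e₁) (e₂ := e₂)
      (e₃ := -e₃) (e₄ := e₄) (by rwa [quarticDisc_neg]) h9 hD0 he₄ ?_ ?_ ?_ h4 ?_ ?_ ?_ ?_ ?_ ht ?_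
    · push_cast; linarith
    · linarith
    · push_cast; linarith
    · linarith
    · linarith
    · simpa using hpq
    · simpa using hq
    · simpa using hst
    · linarith

end SmallQuartics

/-! ### The quartic subfield and its discriminant -/

section QuarticSubfield

theorem card_pointStabilizer {G : Type*} [Group G] (φ : G ≃* alternatingGroup (Fin 4)) :
    Nat.card (pointStabilizer φ) = 3 := by
  obtain ⟨a, ha⟩ := exists_sq_ne_one
  obtain ⟨g, hg⟩ := exists_conj_mem_pointStabilizer_iff φ (τ := φ.symm a) (by simpa using ha)
  rw [hg, Nat.card_zpowers]
  have h3 := pow_three_eq_one_of_sq_ne_one a ha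
  refine orderOf_eq_prime ?_ fun h ↦ ha ?_
  · rw [conj_pow, ← map_pow, h3, map_one, mul_one, mul_inv_cancel]
  · have : φ.symm a = 1 := by
      rw [mul_inv_eq_one, mul_eq_left] at h
      exact h
    rw [map_eq_one_iff _ φ.symm.injective] at this
    simp [this]

variable {E : Type*} [Field E] [NumberField E]
  (φ : Gal(E/ℚ) ≃* alternatingGroup (Fin 4))

/-- The quartic subfield fixed by the stabilizer of a point. -/
abbrev quarticField : IntermediateField ℚ E := IntermediateField.fixedField (pointStabilizer φ)

/-- The embeddings of the quartic field obtained by conjugating the inclusion. -/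
noncomputable def quarticEmbedding (ι : E →+* ℂ) (i : Fin 4) : quarticField φ →ₐ[ℚ] ℂ :=
  ((ι.toRatAlgHom).comp (pointTransport φ i : E ≃ₐ[ℚ] E).toAlgHom).comp (quarticField φ).val

theorem quarticEmbedding_apply (ι : E →+* ℂ) (i : Fin 4) (z : quarticField φ) :
    quarticEmbedding φ ι i z = ι (pointTransport φ i (z : E)) := rfl

theorem quarticEmbedding_injective (ι : E →+* ℂ) : Function.Injective (quarticEmbedding φ ι) := by
  intro i j hij
  have h : (pointTransport φ j)⁻¹ * pointTransport φ i ∈ pointStabilizer φ := by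
    rw [← IntermediateField.fixingSubgroup_fixedField (pointStabilizer φ),
      IntermediateField.mem_fixingSubgroup_iff]
    intro z hz
    have := DFunLike.congr_fun hij ⟨z, hz⟩
    rw [quarticEmbedding_apply, quarticEmbedding_apply] at this
    have h2 := ι.injective this
    rw [AlgEquiv.mul_apply, h2]
    exact (pointTransport φ j).symm_apply_apply z
  rw [mem_pointStabilizer, map_mul, map_inv] at h
  simp only [Subgroup.coe_mul, Subgroup.coe_inv, Equiv.Perm.mul_apply] at h
  rw [Equiv.Perm.inv_eq_iff_eq, apply_pointTransport, apply_pointTransport] at h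
  exact h

theorem smul_algebraMap_of_mem (y : 𝓞 (quarticField φ)) {h : Gal(E/ℚ)}
    (hh : h ∈ pointStabilizer φ) : h • algebraMap (𝓞 (quarticField φ)) (𝓞 E) y =
      algebraMap (𝓞 (quarticField φ)) (𝓞 E) y := by
  apply RingOfIntegers.ext
  exact (y : quarticField φ).2 ⟨h, hh⟩

variable [IsGalois ℚ E]

theorem finrank_quarticField : Module.finrank ℚ (quarticField φ) = 4 := by
  have h1 := IntermediateField.finrank_fixedField_eq_card (pointStabilizer φ)
  rw [card_pointStabilizer] at h1
  have h2 := Module.finrank_mul_finrank ℚ (quarticField φ) E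
  rw [h1, ← IsGalois.card_aut_eq_finrank ℚ E, Nat.card_congr φ.toEquiv, Nat.card_eq_fintype_card,
    show Fintype.card (alternatingGroup (Fin 4)) = 12 by decide +kernel] at h2
  lia

/-- The four embeddings of the quartic field. -/
noncomputable def quarticEmbeddings (ι : E →+* ℂ) : Fin 4 ≃ (quarticField φ →ₐ[ℚ] ℂ) :=
  Equiv.ofBijective (quarticEmbedding φ ι) <| by
    rw [Fintype.bijective_iff_injective_and_card]
    refine ⟨quarticEmbedding_injective φ ι, ?_⟩
    rw [AlgHom.card, finrank_quarticField, Fintype.card_fin]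

theorem quarticEmbeddings_apply (ι : E →+* ℂ) (i : Fin 4) (z : quarticField φ) :
    quarticEmbeddings φ ι i z = ι (pointTransport φ i (z : E)) := rfl

theorem exists_algebraMap_eq_of_fixed {x : 𝓞 E} (hx : ∀ h ∈ pointStabilizer φ, h • x = x) :
    ∃ y : 𝓞 (quarticField φ), algebraMap (𝓞 (quarticField φ)) (𝓞 E) y = x := by
  have : IsGaloisGroup (pointStabilizer φ) (quarticField φ) E :=
    IsGaloisGroup.subgroup Gal(E/ℚ) ℚ E (pointStabilizer φ)
  have : IsGaloisGroup (pointStabilizer φ) (𝓞 (quarticField φ)) (𝓞 E) :=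
    IsGaloisGroup.of_isFractionRing _ _ _ (quarticField φ) E
  exact Algebra.IsInvariant.isInvariant (A := 𝓞 (quarticField φ)) (G := pointStabilizer φ) x
    fun g ↦ hx g g.2

theorem exists_int_eq_det_vandermonde {a : Fin 4 → 𝓞 E} (ha : IsEquivariantFamily φ a) :
    ∃ d : ℤ, (d : 𝓞 E) = (Matrix.vandermonde a).det := by
  obtain ⟨d, hd⟩ := Algebra.IsInvariant.isInvariant (A := ℤ) (G := Gal(E/ℚ)) _
    (smul_det_vandermonde φ ha)
  exact ⟨d, by simpa using hd⟩

/-- Here m is the determinant of 1, y, y², y³ over an integral basis, with y the element x viewed in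
the quartic field. -/
theorem sq_eq_discr_mul_sq {x : 𝓞 E} (hx : ∀ h ∈ pointStabilizer φ, h • x = x) {d : ℤ}
    (hd : (d : 𝓞 E) = (Matrix.vandermonde fun i ↦ pointTransport φ i • x).det) :
    ∃ m : ℤ, d ^ 2 = discr (quarticField φ) * m ^ 2 := by
  obtain ⟨y, rfl⟩ := exists_algebraMap_eq_of_fixed φ hx
  let ι : E →+* ℂ := Classical.choice inferInstance
  have hrank : Module.finrank ℤ (𝓞 (quarticField φ)) = 4 := by
    rw [RingOfIntegers.rank, finrank_quarticField]
  let b : Module.Basis (Fin 4) ℤ (𝓞 (quarticField φ)) := Module.finBasisOfFinrankEq _ _ hrank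
  let v : Fin 4 → 𝓞 (quarticField φ) := fun i ↦ y ^ (i : ℕ)
  have h1 : Algebra.discr ℤ v = (b.toMatrix v).det ^ 2 * discr (quarticField φ) := by
    rw [← NumberField.discr_eq_discr _ b, ← Algebra.discr_of_matrix_vecMul,
      Module.Basis.toMatrix_map_vecMul]
  have h2 : ((Algebra.discr ℤ v : ℤ) : ℚ) =
      Algebra.discr ℚ (fun i ↦ (v i : quarticField φ)) := by
    rw [Algebra.discr_def, Algebra.discr_def, ← eq_intCast (Int.castRingHom ℚ), RingHom.map_det]
    congr 1
    ext i j
    simp only [RingHom.mapMatrix_apply, Matrix.map_apply, Algebra.traceMatrix_apply,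
      Algebra.traceForm_apply, eq_intCast, Algebra.coe_trace_int, map_mul]
  have h3 := Algebra.discr_eq_det_embeddingsMatrixReindex_pow_two ℚ ℂ
    (fun i ↦ (v i : quarticField φ)) (quarticEmbeddings φ ι)
  have h4 : Algebra.embeddingsMatrixReindex ℚ ℂ (fun i ↦ (v i : quarticField φ))
      (quarticEmbeddings φ ι) = ((Matrix.vandermonde fun i ↦ pointTransport φ i •
        algebraMap (𝓞 (quarticField φ)) (𝓞 E) y).map
          (ι.comp (algebraMap (𝓞 E) E))).transpose := by
    ext i j
    simp only [Algebra.embeddingsMatrixReindex, Matrix.reindex_apply, Matrix.submatrix_apply,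
      Equiv.symm_symm, Equiv.refl_symm, Equiv.refl_apply, Algebra.embeddingsMatrix_apply,
      Matrix.transpose_apply, Matrix.map_apply, Matrix.vandermonde_apply, v, map_pow,
      quarticEmbeddings_apply]
    rfl
  rw [h4, Matrix.det_transpose, ← RingHom.mapMatrix_apply, ← RingHom.map_det, ← hd, ← h2, h1] at h3
  refine ⟨(b.toMatrix v).det, ?_⟩
  have h5 : (((b.toMatrix v).det ^ 2 * discr (quarticField φ) : ℤ) : ℂ) = ((d ^ 2 : ℤ) : ℂ) := by
    simpa using h3
  rw [mul_comm, ← Int.cast_injective h5]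

/-- Only 3 can divide the discriminant; a factor 3⁵ would divide d² for every Vandermonde
determinant d, forcing 27 ∣ d. -/
theorem abs_discr_quarticField_le (hram : RationalPrimeRamifies E 3)
    (hp : ∀ q : ℕ, RationalPrimeRamifies E q → q = 3) : |discr (quarticField φ)| ≤ 81 := by
  obtain ⟨-, P₀, hP₀, h3P₀, -⟩ := hram
  obtain ⟨P, hP, h3P, hI⟩ := exists_prime_inertia_eq_pointStabilizer φ hp P₀ h3P₀
  obtain ⟨x, hx, hx27⟩ := exists_fixed_not_dvd_det_vandermonde φ hp P h3P hI
  obtain ⟨d, hd⟩ := exists_int_eq_det_vandermonde φ (isEquivariantFamily_of_fixed φ hx)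
  obtain ⟨m, hm⟩ := sq_eq_discr_mul_sq φ hx hd
  have h27 := hx27 d hd
  have hD0 : (discr (quarticField φ)).natAbs ≠ 0 := by simpa using discr_ne_zero _
  have hprimes : ∀ q : ℕ, q.Prime → q ∣ (discr (quarticField φ)).natAbs → q = 3 := by
    intro q hq hqD
    by_contra hq3
    have hq' : Prime (q : ℤ) := Nat.prime_iff_prime_int.mp hq
    refine (NumberField.not_dvd_discr_iff_forall_mem (quarticField φ) (𝓞 (quarticField φ)) hq').mpr
      ?_ (Int.natCast_dvd.mpr hqD)
    intro Q hQ hqQ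
    obtain ⟨⟨R, hR, hRQ⟩⟩ := (inferInstance : Nonempty (Q.primesOver (𝓞 E)))
    have hqR : (q : 𝓞 E) ∈ R := by
      have : algebraMap (𝓞 (quarticField φ)) (𝓞 E) (q : ℤ) ∈ R :=
        (Ideal.mem_of_liesOver R Q _).mp hqQ
      simpa using this
    have : Algebra.IsUnramifiedAt ℤ R := by
      by_contra hcon
      exact hq3 (hp q ⟨hq, R, hR, hqR, hcon⟩)
    exact Algebra.IsUnramifiedAt.of_liesOver ℤ Q R
  have hpow := Nat.eq_prime_pow_of_unique_prime_dvd hD0 (fun {q} hq hqD ↦ hprimes q hq hqD)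
  have hlt : (discr (quarticField φ)).natAbs.primeFactorsList.length ≤ 4 := by
    by_contra! hcon
    apply h27
    have h5 : (3 : ℤ) ^ 5 ∣ d ^ 2 := by
      rw [hm]
      refine Dvd.dvd.mul_right (Int.dvd_natAbs.mp ?_) _
      rw [hpow]
      exact_mod_cast pow_dvd_pow 3 hcon
    have h6 : (3 : ℤ) ∣ d := Int.prime_three.dvd_of_dvd_pow (dvd_trans (by norm_num) h5)
    obtain ⟨d, rfl⟩ := h6
    have h7 : (3 : ℤ) ^ 3 ∣ d ^ 2 := by
      have : (3 : ℤ) ^ 2 * 3 ^ 3 ∣ 3 ^ 2 * d ^ 2 := by rwa [← pow_add, ← mul_pow]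
      exact (mul_dvd_mul_iff_left (by norm_num)).mp this
    obtain ⟨d, rfl⟩ : (3 : ℤ) ∣ d := Int.prime_three.dvd_of_dvd_pow (dvd_trans (by norm_num) h7)
    have h8 : (3 : ℤ) ∣ d ^ 2 := by
      have : (3 : ℤ) ^ 2 * 3 ∣ 3 ^ 2 * d ^ 2 := by rwa [← pow_succ, ← mul_pow]
      exact (mul_dvd_mul_iff_left (by norm_num)).mp this
    obtain ⟨d, rfl⟩ : (3 : ℤ) ∣ d := Int.prime_three.dvd_of_dvd_pow h8
    exact ⟨d, by ring⟩
  rw [Int.abs_eq_natAbs, hpow]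
  exact_mod_cast Nat.pow_le_pow_right (by norm_num : 0 < 3) hlt

end QuarticSubfield

/-! ### Minkowski's theorem in a totally complex quartic field -/

section TotallyComplexQuartic

open InfinitePlace mixedEmbedding ENNReal NNReal Real

open scoped Classical in
-- With bound B on the imaginary part, the convex body has volume 4π · B · 9/4, and the Minkowski
-- bound is at most 2⁴ · 9/4 = 36. Any B > 4/π suffices; 637/500 is just above.
theorem exists_small_of_isTotallyComplex (K : Type*) [Field K] [NumberField K] [IsTotallyComplex K]
    (hK : Module.finrank ℚ K = 4) (hD : |discr K| ≤ 81) (w₀ : InfinitePlace K) :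
    ∃ a : 𝓞 K, a ≠ 0 ∧ (∀ w : InfinitePlace K, w ≠ w₀ → w a < 3 / 2) ∧
      |(w₀.embedding a).re| < 1 ∧ |(w₀.embedding a).im| < 637 / 500 := by
  have hcomplex : nrComplexPlaces K = 2 := by
    have := IsTotallyComplex.finrank (K := K)
    lia
  have hreal : nrRealPlaces K = 0 := IsTotallyComplex.nrRealPlaces_eq_zero K
  have hcard : (Finset.univ.erase w₀).card = 1 := by
    have := card_eq_nrRealPlaces_add_nrComplexPlaces K
    rw [Finset.card_erase_of_mem (Finset.mem_univ _), Finset.card_univ, this]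
    lia
  -- The square root appears because `convexBodyLT'` bounds the imaginary part at w₀ by the square
  -- of f.
  let f : InfinitePlace K → ℝ≥0 := fun w ↦ if w = w₀ then NNReal.sqrt (637 / 500) else 3 / 2
  have hprod : ∏ w, f w ^ mult w = 637 / 500 * (9 / 4) := by
    rw [← Finset.mul_prod_erase _ _ (Finset.mem_univ w₀)]
    congr 1
    · simp [f, IsTotallyComplex.mult_eq]
    · rw [Finset.prod_congr rfl (g := fun _ ↦ 9 / 4), Finset.prod_const, hcard, pow_one]
      intro w hw
      simp only [f, IsTotallyComplex.mult_eq, if_neg (Finset.ne_of_mem_erase hw)]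
      norm_num
  have hdisc : NNReal.sqrt ‖discr K‖₊ ≤ 9 := by
    rw [NNReal.sqrt_le_iff_le_sq, ← NNReal.coe_le_coe, coe_nnnorm, Int.norm_eq_abs]
    push_cast
    exact_mod_cast (by norm_num at *; exact hD : |discr K| ≤ 9 ^ 2)
  have hvol : minkowskiBound K ↑1 <
      MeasureTheory.volume (convexBodyLT' K f ⟨w₀, IsTotallyComplex.isComplex w₀⟩) := by
    rw [convexBodyLT'_volume, minkowskiBound, volume_fundamentalDomain_fractionalIdealLatticeBasis,
      Units.val_one, FractionalIdeal.absNorm_one, Rat.cast_one, ENNReal.ofReal_one, one_mul,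
      mixedEmbedding.finrank, volume_fundamentalDomain_latticeBasis, hK, hcomplex, hprod,
      convexBodyLT'Factor, hreal, hcomplex]
    have h2 : (2 : ℝ≥0∞) = ((2 : ℝ≥0) : ℝ≥0∞) := rfl
    rw [h2, ← ENNReal.coe_inv two_ne_zero, ← ENNReal.coe_pow, ← ENNReal.coe_pow, ← ENNReal.coe_mul,
      ← ENNReal.coe_mul, ← ENNReal.coe_mul, ENNReal.coe_lt_coe, ← NNReal.coe_lt_coe]
    have h9 : (NNReal.sqrt ‖discr K‖₊ : ℝ) ≤ 9 := hdisc
    push_cast at h9 ⊢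
    rw [NNReal.coe_real_pi]
    nlinarith [Real.pi_gt_d4]
  obtain ⟨a, ha0, ha, hre, him⟩ := exists_ne_zero_mem_ringOfIntegers_lt' K _ hvol
  refine ⟨a, ha0, fun w hw ↦ ?_, hre, ?_⟩
  · simpa [f, hw] using ha w hw
  · simp only [f, if_pos, ← NNReal.coe_pow, NNReal.sq_sqrt] at him
    simpa using him

end TotallyComplexQuartic

section SmallQuartics

open ComplexConjugate

theorem no_small_conj_pairs {z w : ℂ} {e₁ e₂ e₃ e₄ D : ℤ}
    (hD : D ^ 2 = quarticDisc e₁ e₂ e₃ e₄) (h9 : 9 ∣ D) (hD0 : D ≠ 0) (he₄ : e₄ ≠ 0)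
    (h1 : (e₁ : ℂ) = z + conj z + (w + conj w))
    (h2 : (e₂ : ℂ) = z * conj z + w * conj w + (z + conj z) * (w + conj w))
    (h3 : (e₃ : ℂ) = (z + conj z) * (w * conj w) + (w + conj w) * (z * conj z))
    (h4 : (e₄ : ℂ) = (z * conj z) * (w * conj w))
    (hre : |z.re| < 1) (him : |z.im| < 637 / 500) (hw : ‖w‖ < 3 / 2) : False := by
  rw [Complex.add_conj, Complex.add_conj] at h1
  rw [Complex.add_conj, Complex.add_conj, Complex.mul_conj, Complex.mul_conj] at h2 h3
  rw [Complex.mul_conj, Complex.mul_conj] at h4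
  have hwn : Complex.normSq w < 9 / 4 := by
    rw [Complex.normSq_eq_norm_sq]
    nlinarith [norm_nonneg w]
  obtain ⟨hre1, hre2⟩ := abs_lt.mp hre
  refine no_small_quartic hD h9 hD0 he₄ (p := 2 * z.re) (q := Complex.normSq z) (s := 2 * w.re)
    (t := Complex.normSq w) (by exact_mod_cast h1) (by exact_mod_cast h2) (by exact_mod_cast h3)
    (by exact_mod_cast h4) (by linarith) (by linarith) ?_ ?_ ?_ hwn
  · rw [Complex.normSq_apply]; nlinarith [sq_nonneg z.im]
  · rw [Complex.normSq_apply]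
    have : z.im ^ 2 < (637 / 500) ^ 2 := by
      rw [sq_lt_sq, abs_of_pos (by norm_num : (0 : ℝ) < 637 / 500)]; exact him
    nlinarith
  · rw [Complex.normSq_apply]; nlinarith [sq_nonneg w.im]

end SmallQuartics

/-! ### Symmetric functions of equivariant families -/

section EquivariantFamilies

theorem exists_apply_eq_and_apply_eq : ∀ i j k l : Fin 4, i ≠ j → k ≠ l →
    ∃ a : alternatingGroup (Fin 4), (a : Equiv.Perm (Fin 4)) i = k ∧
      (a : Equiv.Perm (Fin 4)) j = l := by
  decide +kernel

theorem apply_of_involution : ∀ a : alternatingGroup (Fin 4), a ^ 2 = 1 → a ≠ 1 →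
    ((a : Equiv.Perm (Fin 4)) 0 = 1 ∧ (a : Equiv.Perm (Fin 4)) 2 = 3) ∨
    ((a : Equiv.Perm (Fin 4)) 0 = 2 ∧ (a : Equiv.Perm (Fin 4)) 1 = 3) ∨
    ((a : Equiv.Perm (Fin 4)) 0 = 3 ∧ (a : Equiv.Perm (Fin 4)) 1 = 2) := by
  decide +kernel

theorem apply_ne_of_involution : ∀ a : alternatingGroup (Fin 4), a ^ 2 = 1 → a ≠ 1 →
    ∀ i, (a : Equiv.Perm (Fin 4)) i ≠ i := by
  decide +kernel

/-- A₄ is doubly transitive, so one coincidence spreads to every pair. -/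
theorem IsEquivariantFamily.eq_of_det_vandermonde_eq_zero {G : Type*} [Group G]
    {φ : G ≃* alternatingGroup (Fin 4)} {R : Type*} [CommRing R] [IsDomain R]
    [MulSemiringAction G R] {a : Fin 4 → R} (ha : IsEquivariantFamily φ a)
    (h : (Matrix.vandermonde a).det = 0) (k l : Fin 4) : a k = a l := by
  obtain ⟨i, j, hij, hne⟩ := Matrix.det_vandermonde_eq_zero_iff.mp h
  rcases eq_or_ne k l with rfl | hkl
  · rfl
  · obtain ⟨b, hbi, hbj⟩ := exists_apply_eq_and_apply_eq i j k l hne hkl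
    have h1 := ha (φ.symm b) i
    have h2 := ha (φ.symm b) j
    rw [MulEquiv.apply_symm_apply] at h1 h2
    rw [← hbi, ← hbj, ← h1, ← h2, hij]

open Polynomial in
theorem IsEquivariantFamily.smul_coeff_prod {G : Type*} [Group G]
    {φ : G ≃* alternatingGroup (Fin 4)} {R : Type*} [CommRing R]
    [MulSemiringAction G R] {a : Fin 4 → R} (ha : IsEquivariantFamily φ a) (g : G) (n : ℕ) :
    g • (∏ i, (X - C (a i))).coeff n = (∏ i, (X - C (a i))).coeff n := by
  have h : (∏ i, (X - C (a i))).map (MulSemiringAction.toRingHom G R g) =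
      ∏ i, (X - C (a i)) := by
    rw [Polynomial.map_prod, ← Equiv.prod_comp (φ g : Equiv.Perm (Fin 4)) fun i ↦ X - C (a i)]
    refine Finset.prod_congr rfl fun i _ ↦ ?_
    rw [Polynomial.map_sub, map_X, map_C, ← ha, MulSemiringAction.toRingHom_apply]
  conv_rhs => rw [← h, Polynomial.coeff_map, MulSemiringAction.toRingHom_apply]

open Polynomial in
theorem coeff_prod_X_sub_C_four {R : Type*} [CommRing R] (a : Fin 4 → R) :
    (∏ i, (X - C (a i))).coeff 3 = -(a 0 + a 1 + a 2 + a 3) ∧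
    (∏ i, (X - C (a i))).coeff 2 =
      a 0 * a 1 + a 0 * a 2 + a 0 * a 3 + a 1 * a 2 + a 1 * a 3 + a 2 * a 3 ∧
    (∏ i, (X - C (a i))).coeff 1 =
      -(a 0 * a 1 * a 2 + a 0 * a 1 * a 3 + a 0 * a 2 * a 3 + a 1 * a 2 * a 3) ∧
    (∏ i, (X - C (a i))).coeff 0 = a 0 * a 1 * a 2 * a 3 := by
  have hexp : ∏ i, (X - C (a i)) = X ^ 4 - C (a 0 + a 1 + a 2 + a 3) * X ^ 3 +
      C (a 0 * a 1 + a 0 * a 2 + a 0 * a 3 + a 1 * a 2 + a 1 * a 3 + a 2 * a 3) * X ^ 2 -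
      C (a 0 * a 1 * a 2 + a 0 * a 1 * a 3 + a 0 * a 2 * a 3 + a 1 * a 2 * a 3) * X +
      C (a 0 * a 1 * a 2 * a 3) := by
    rw [Fin.prod_univ_four]
    simp only [C_add, C_mul]
    ring
  rw [hexp]
  simp [coeff_X, coeff_C, coeff_X_pow, -map_add, -map_mul]

open Polynomial in
theorem exists_int_esymm {E : Type*} [Field E] [NumberField E] [IsGalois ℚ E]
    {φ : Gal(E/ℚ) ≃* alternatingGroup (Fin 4)} {a : Fin 4 → 𝓞 E} (ha : IsEquivariantFamily φ a) :
    ∃ e₁ e₂ e₃ e₄ : ℤ, (e₁ : 𝓞 E) = a 0 + a 1 + a 2 + a 3 ∧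
      (e₂ : 𝓞 E) = a 0 * a 1 + a 0 * a 2 + a 0 * a 3 + a 1 * a 2 + a 1 * a 3 + a 2 * a 3 ∧
      (e₃ : 𝓞 E) = a 0 * a 1 * a 2 + a 0 * a 1 * a 3 + a 0 * a 2 * a 3 + a 1 * a 2 * a 3 ∧
      (e₄ : 𝓞 E) = a 0 * a 1 * a 2 * a 3 := by
  have h : ∀ n, ∃ c : ℤ, (c : 𝓞 E) = (∏ i, (X - C (a i))).coeff n := by
    intro n
    obtain ⟨c, hc⟩ := Algebra.IsInvariant.isInvariant (A := ℤ) (G := Gal(E/ℚ)) _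
      fun g ↦ ha.smul_coeff_prod g n
    exact ⟨c, by simpa using hc⟩
  obtain ⟨h3', h2', h1', h0'⟩ := coeff_prod_X_sub_C_four a
  obtain ⟨c₀, h0⟩ := h 0
  obtain ⟨c₁, h1⟩ := h 1
  obtain ⟨c₂, h2⟩ := h 2
  obtain ⟨c₃, h3⟩ := h 3
  refine ⟨-c₃, c₂, -c₁, c₀, ?_, h2.trans h2', ?_, h0.trans h0'⟩
  · rw [Int.cast_neg, h3, h3', neg_neg]
  · rw [Int.cast_neg, h1, h1', neg_neg]

end EquivariantFamilies

/-! ### Complex conjugation as an element of A₄ -/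

section ComplexConjugation

open ComplexConjugate InfinitePlace

theorem exists_conj_eq {E : Type*} [Field E] [NumberField E] [IsGalois ℚ E] (ι : E →+* ℂ) :
    ∃ c : Gal(E/ℚ), c ^ 2 = 1 ∧ ∀ z : E, conj (ι z) = ι (c z) := by
  obtain ⟨σ, hσ⟩ := NumberField.ComplexEmbedding.exists_comp_symm_eq_of_comp_eq (k := ℚ) ι
    (ComplexEmbedding.conjugate ι) (Subsingleton.elim _ _)
  have h : ∀ z, conj (ι z) = ι (σ⁻¹ z) := fun z ↦ (DFunLike.congr_fun hσ z).symm
  refine ⟨σ⁻¹, AlgEquiv.ext fun z ↦ ι.injective ?_, h⟩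
  rw [pow_two, AlgEquiv.mul_apply, ← h, ← h, Complex.conj_conj, AlgEquiv.one_apply]

variable {E : Type*} [Field E] [NumberField E] [IsGalois ℚ E]
  (φ : Gal(E/ℚ) ≃* alternatingGroup (Fin 4)) {ι : E →+* ℂ}

theorem exists_eq_quarticEmbeddings (ι : E →+* ℂ) (ψ : quarticField φ →+* ℂ) :
    ∃ i, ∀ z, ψ z = quarticEmbeddings φ ι i z := by
  obtain ⟨i, hi⟩ := (quarticEmbeddings φ ι).surjective ψ.toRatAlgHom
  exact ⟨i, fun z ↦ by rw [hi]; rfl⟩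

variable {c : Gal(E/ℚ)} (hc : ∀ z : E, conj (ι z) = ι (c z))
include hc

theorem conj_quarticEmbeddings (i : Fin 4) (z : quarticField φ) :
    conj (quarticEmbeddings φ ι i z) =
      quarticEmbeddings φ ι ((φ c : Equiv.Perm (Fin 4)) i) z := by
  have h := isEquivariantFamily_of_fixed φ (x := (z : E)) (fun h hh ↦ z.2 ⟨h, hh⟩) c i
  rw [quarticEmbeddings_apply, quarticEmbeddings_apply, hc]
  exact congrArg ι h

theorem isTotallyReal_quarticField (h1 : c = 1) : IsTotallyReal (quarticField φ) := by
  refine ⟨fun w ↦ ?_⟩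
  rw [isReal_iff, ComplexEmbedding.isReal_iff]
  obtain ⟨i, hi⟩ := exists_eq_quarticEmbeddings φ ι w.embedding
  ext z
  rw [ComplexEmbedding.conjugate_coe_eq, hi, conj_quarticEmbeddings φ hc, h1, map_one]
  rfl

/-- An involution of A₄ moves every point, so conjugation fixes no embedding. -/
theorem isTotallyComplex_quarticField (h2 : c ^ 2 = 1) (h1 : c ≠ 1) :
    IsTotallyComplex (quarticField φ) := by
  refine ⟨fun w ↦ ?_⟩
  rw [isComplex_iff, ComplexEmbedding.isReal_iff]
  intro hw
  obtain ⟨i, hi⟩ := exists_eq_quarticEmbeddings φ ι w.embedding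
  refine apply_ne_of_involution (φ c) (by rw [← map_pow, h2, map_one]) (by simpa using h1) i
    ((quarticEmbeddings φ ι).injective (AlgHom.ext fun z ↦ ?_))
  rw [← conj_quarticEmbeddings φ hc, ← hi, ← ComplexEmbedding.conjugate_coe_eq, hw]

end ComplexConjugation

/-! ### The prime 3 cannot be the only ramified prime -/

section OnlyThree

open ComplexConjugate InfinitePlace

/-- Minkowski's bound is (4⁴/4!)² = 1024/9 > 81. -/
theorem abs_discr_gt_of_isTotallyReal (K : Type*) [Field K] [NumberField K] [IsTotallyReal K]
    (hK : Module.finrank ℚ K = 4) : 81 < |discr K| := by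
  have h := abs_discr_ge' K
  rw [IsTotallyReal.nrComplexPlaces_eq_zero, hK] at h
  norm_num [Nat.factorial] at h
  have : (81 : ℝ) < |(discr K : ℝ)| := by linarith
  exact_mod_cast this

theorem not_ramifies_only_three {E : Type*} [Field E] [NumberField E] [IsGalois ℚ E]
    (φ : Gal(E/ℚ) ≃* alternatingGroup (Fin 4)) (hram : RationalPrimeRamifies E 3)
    (hp : ∀ q : ℕ, RationalPrimeRamifies E q → q = 3) : False := by
  have hdisc := abs_discr_quarticField_le φ hram hp
  let ι : E →+* ℂ := Classical.choice inferInstance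
  obtain ⟨c, hc2, hc⟩ := exists_conj_eq ι
  by_cases hc1 : c = 1
  · have := isTotallyReal_quarticField φ hc hc1
    exact (abs_discr_gt_of_isTotallyReal _ (finrank_quarticField φ)).not_ge hdisc
  have := isTotallyComplex_quarticField φ hc hc2 hc1
  let w₀ : InfinitePlace (quarticField φ) := InfinitePlace.mk (quarticEmbeddings φ ι 0).toRingHom
  obtain ⟨y, hy0, hy, hre, him⟩ :=
    exists_small_of_isTotallyComplex _ (finrank_quarticField φ) hdisc w₀
  let z : Fin 4 → ℂ := fun i ↦ quarticEmbeddings φ ι i y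
  have hzc : ∀ i, conj (z i) = z ((φ c : Equiv.Perm (Fin 4)) i) :=
    fun i ↦ conj_quarticEmbeddings φ hc i y
  have hsmall : |(z 0).re| < 1 ∧ |(z 0).im| < 637 / 500 := by
    rcases embedding_mk_eq (quarticEmbeddings φ ι 0).toRingHom with h | h
    · rw [h] at hre him
      exact ⟨hre, him⟩
    · rw [h, ComplexEmbedding.conjugate_coe_eq] at hre him
      rw [Complex.conj_re] at hre
      rw [Complex.conj_im, abs_neg] at him
      exact ⟨hre, him⟩
  have hother : ∀ k, k ≠ 0 → k ≠ (φ c : Equiv.Perm (Fin 4)) 0 → ‖z k‖ < 3 / 2 := by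
    intro k hk0 hkc
    refine hy (InfinitePlace.mk (quarticEmbeddings φ ι k).toRingHom) fun h ↦ ?_
    rcases mk_eq_iff.mp h.symm with h | h
    · exact hk0 ((quarticEmbeddings φ ι).injective
        (AlgHom.ext fun u ↦ (DFunLike.congr_fun h u).symm))
    · refine hkc ((quarticEmbeddings φ ι).injective (AlgHom.ext fun u ↦ ?_))
      rw [← conj_quarticEmbeddings φ hc]
      exact (DFunLike.congr_fun h u).symm
  let a : Fin 4 → 𝓞 E := fun i ↦ pointTransport φ i • algebraMap (𝓞 (quarticField φ)) (𝓞 E) y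
  have ha : IsEquivariantFamily φ a :=
    isEquivariantFamily_of_fixed φ fun h hh ↦ smul_algebraMap_of_mem φ y hh
  let κ : 𝓞 E →+* ℂ := ι.comp (algebraMap (𝓞 E) E)
  have hκ : Function.Injective κ := ι.injective.comp RingOfIntegers.coe_injective
  have hκa : ∀ i, κ (a i) = z i := fun i ↦ rfl
  obtain ⟨e₁, e₂, e₃, e₄, h1, h2, h3, h4⟩ := exists_int_esymm ha
  obtain ⟨d, hd⟩ := exists_int_eq_det_vandermonde φ ha
  have hdd : d ^ 2 = quarticDisc e₁ e₂ e₃ e₄ := by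
    have := det_vandermonde_sq_eq_quarticDisc a
    rw [← hd, ← h1, ← h2, ← h3, ← h4] at this
    have h5 : ((d ^ 2 : ℤ) : 𝓞 E) = (quarticDisc e₁ e₂ e₃ e₄ : ℤ) := by
      rw [Int.cast_pow, this]
      simp [quarticDisc]
    exact Int.cast_injective h5
  have hd9 : 9 ∣ d := by
    obtain ⟨-, P₀, hP₀, h3P₀, -⟩ := hram
    obtain ⟨P, hP, h3P, hI⟩ := exists_prime_inertia_eq_pointStabilizer φ hp P₀ h3P₀
    exact nine_dvd_of_det_vandermonde φ hp P h3P hI ha hd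
  have hz0 : ∀ i, z i ≠ 0 := by
    intro i hi
    have : (y : quarticField φ) = 0 :=
      (quarticEmbeddings φ ι i).injective (by rw [map_zero]; exact hi)
    exact hy0 (RingOfIntegers.coe_eq_zero_iff.mp this)
  replace h1 := congrArg κ h1
  replace h2 := congrArg κ h2
  replace h3 := congrArg κ h3
  replace h4 := congrArg κ h4
  simp only [map_add, map_mul, map_intCast, hκa] at h1 h2 h3 h4
  have he4 : e₄ ≠ 0 := by
    rintro rfl
    rw [Int.cast_zero, eq_comm] at h4
    simp [hz0] at h4
  -- If the conjugates coincided, z 0 would be real with |z 0| < 1, and the integer e₄ = (z 0)⁴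
  -- would vanish.
  have hd0 : d ≠ 0 := by
    rintro rfl
    have heq : ∀ i, z i = z 0 := fun i ↦ congrArg κ
      (ha.eq_of_det_vandermonde_eq_zero (by rw [← hd, Int.cast_zero]) i 0)
    have hreal : ((z 0).re : ℂ) = z 0 := Complex.conj_eq_iff_re.mp ((hzc 0).trans (heq _))
    rw [heq 1, heq 2, heq 3, ← hreal] at h4
    have h5 : (e₄ : ℝ) = ((z 0).re ^ 2) ^ 2 := by
      have : (e₄ : ℝ) = (z 0).re * (z 0).re * (z 0).re * (z 0).re := by exact_mod_cast h4
      rw [this]; ring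
    have h6 : (z 0).re ^ 2 < 1 := (sq_lt_one_iff_abs_lt_one _).mpr hsmall.1
    have h7 : (e₄ : ℝ) < 1 := by rw [h5]; nlinarith [sq_nonneg (z 0).re]
    have h8 : (0 : ℝ) ≤ e₄ := by rw [h5]; positivity
    norm_cast at h7 h8
    lia
  -- The double transposition determines which index is conjugate to 0 and which two form the other
  -- pair.
  rcases apply_of_involution (φ c) (by rw [← map_pow, hc2, map_one]) (by simpa using hc1) with
    ⟨hj, hk⟩ | ⟨hj, hk⟩ | ⟨hj, hk⟩
  · have hcj := hj ▸ hzc 0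
    have hck := hk ▸ hzc 2
    refine no_small_conj_pairs (z := z 0) (w := z 2) hdd hd9 hd0 he4 ?_ ?_ ?_ ?_ hsmall.1 hsmall.2
      (hother _ (by decide) (by rw [hj]; decide)) <;> rw [hcj, hck]
    · rw [h1]; ring
    · rw [h2]; ring
    · rw [h3]; ring
    · rw [h4]; ring
  · have hcj := hj ▸ hzc 0
    have hck := hk ▸ hzc 1
    refine no_small_conj_pairs (z := z 0) (w := z 1) hdd hd9 hd0 he4 ?_ ?_ ?_ ?_ hsmall.1 hsmall.2
      (hother _ (by decide) (by rw [hj]; decide)) <;> rw [hcj, hck]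
    · rw [h1]; ring
    · rw [h2]; ring
    · rw [h3]; ring
    · rw [h4]; ring
  · have hcj := hj ▸ hzc 0
    have hck := hk ▸ hzc 1
    refine no_small_conj_pairs (z := z 0) (w := z 1) hdd hd9 hd0 he4 ?_ ?_ ?_ ?_ hsmall.1 hsmall.2
      (hother _ (by decide) (by rw [hj]; decide)) <;> rw [hcj, hck]
    · rw [h1]; ring
    · rw [h2]; ring
    · rw [h3]; ring
    · rw [h4]; ring

end OnlyThree

theorem mainTheorem2 (E : Type*) [Field E] [NumberField E] [IsGalois ℚ E]
    (φ : Gal(E/ℚ) ≃* alternatingGroup (Fin 4))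
    (hE : ∃! p : ℕ, RationalPrimeRamifies E p) :
    AllRamificationOfType E
      {g : Gal(E/ℚ) | Equiv.Perm.IsThreeCycle (φ g : Equiv.Perm (Fin 4))} := by
  obtain ⟨p, hram, hp⟩ := hE
  have hp3 : p ≠ 3 := by
    rintro rfl
    exact not_ramifies_only_three φ hram hp
  have hpp := hram.1
  have hmem : ∀ (P : Ideal (𝓞 E)) [P.IsPrime], P ≠ ⊥ → ¬ Algebra.IsUnramifiedAt ℤ P →
      (p : 𝓞 E) ∈ P := by
    intro P _ hP0 hP
    exact natCast_mem_of_not_isUnramifiedAt hp P hP0 hP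
  refine ⟨?_, ?_⟩
  · intro P ℓ hP hℓ hℓP
    have hP0 := ne_bot_of_natCast_mem hℓ hℓP
    by_cases hun : Algebra.IsUnramifiedAt ℤ P
    · rw [Ideal.ramificationIdx_eq_one]
      exact hℓ.not_dvd_one
    · obtain rfl : ℓ = p := hp ℓ ⟨hℓ, P, hP, hℓP, hun⟩
      obtain ⟨τ, hτ, hI⟩ := exists_inertia_eq_zpowers φ hpp hp P hℓP
      have h3 : orderOf τ = 3 := orderOf_eq_prime
        (φ.injective (by simpa using pow_three_eq_one_of_sq_ne_one _ hτ)) fun h ↦ hτ (by simp [h])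
      rw [← card_inertia_eq_ramificationIdx, ← hI, Nat.card_zpowers, h3]
      exact fun h ↦ hp3 ((Nat.prime_dvd_prime_iff_eq hℓ Nat.prime_three).mp h)
  · intro P hP hP0
    by_cases hun : Algebra.IsUnramifiedAt ℤ P
    · exact Or.inl hun
    · obtain ⟨τ, hτ, hI⟩ := exists_inertia_eq_zpowers φ hpp hp P (hmem P hP0 hun)
      exact Or.inr ⟨τ, isThreeCycle_of_sq_ne_one _ hτ, hI⟩
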